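/- Notation. Let $d\ge 0$ be an integer. A *quasi-Lévy type measure* $\nu$ on $\mathbb R^d$ is a real-valued function on the Borel sets of $\mathbb R^d$ that are bounded away from $0$, such that for every $r>0$ its restriction to the Borel subsets of $\{|x|\ge r\}$ is a finite signed measure and such that $\int (1\wedge|x|^2)\,\nu^{\pm}(dx)<\infty$. Here $\nu^+,\nu^-$ are the unique Borel measures on $\mathbb R^d$ with $\nu^{\pm}(\{0\})=0$ which, on the Borel subsets of $\{|x|\ge r\}$, are the positive and the negative part of the Jordan decomposition of this restriction, for every $r>0$. A function is $\nu$-integrable if it is integrable with respect to $\nu^+$ and $\nu^-$, and then $\int f\,d\nu=\int f\,d\nu^+-\int f\,d\nu^-$. A probability measure $\mu$ on $\mathbb R^d$ is *quasi-infinitely divisible* if $\widehat\mu=\widehat\mu_1/\widehat\mu_2$ for two infinitely divisible distributions $\mu_1,\mu_2$; it has *standard characteristic triplet* $(A,\nu,\gamma)$ if $A\in\mathbb R^{d\times d}$ is symmetric, $\nu$ is a quasi-Lévy type measure, $\gamma\in\mathbb R^d$, and for all $z\in\mathbb R^d$ $$\widehat\mu(z)=\exp\Big(i\langle\gamma,z\rangle-\tfrac12\langle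 z,Az\rangle+\int_{\mathbb R^d}\big(e^{i\langle z,x\rangle}-1-i\langle z,x\rangle\mathbf 1_{[0,1]}(|x|)\big)\,\nu(dx)\Big).$$ If $|x|$ is $\nu$-integrable over $\{|x|>1\}$, the *center* of $\mu$ is the vector $\gamma_m\in\mathbb R^d$ such that $\widehat\mu(z)=\exp\big(i\langle\gamma_m,z\rangle-\tfrac12\langle z,Az\rangle+\int_{\mathbb R^d}(e^{i\langle z,x\rangle}-1-i\langle z,x\rangle)\,\nu(dx)\big)$ for all $z\in\mathbb R^d$. A function $h:\mathbb R^d\to[0,\infty)$ is *submultiplicative* if there is $C>0$ with $h(x+y)\le C\,h(x)h(y)$ for all $x,y\in\mathbb R^d$. **Theorem.** Let $\mu$ be a quasi-infinitely divisible distribution on $\mathbb R^d$ with standard characteristic triplet $(A,\nu,\gamma)$. (a) Let $h:\mathbb R^d\to[0,\infty)$ be submultiplicative, locally bounded and measurable. Then $\int_{|x|>1}h\,d\nu^+<\infty$ if and only if both $\int_{\mathbb R^d}h\,d\mu<\infty$ and $\int_{|x|>1}h\,d\nu^-<\infty$. (b) Let $X$ be a random vector in $\mathbb R^d$ with distribution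 $\mu$. (i) If $\int_{|x|>1}|x|\,\nu^+(dx)<\infty$, then $X$ is integrable, $x$ is $\nu$-integrable over $\{|x|>1\}$, and $\mathbb E(X)=\gamma+\int_{|x|>1}x\,\nu(dx)=\gamma_m$, the center of $\mu$. (ii) If $\int_{|x|>1}|x|^2\,\nu^+(dx)<\infty$, then $X$ has finite second moment, the entries of $xx^T$ are $\nu$-integrable, and $\mathrm{Cov}(X)=A+\int_{\mathbb R^d}xx^T\,\nu(dx)$. (iii) If $\alpha\in\mathbb R^d$ and $\int_{|x|>1}e^{\langle\alpha,x\rangle}\,\nu^+(dx)<\infty$, then $\mathbb E(e^{\langle\alpha,X\rangle})<\infty$, the integrand below is $\nu$-integrable, and $$\mathbb E\big(e^{\langle\alpha,X\rangle}\big)=\exp\Big(\langle\alpha,\gamma\rangle+\tfrac12\langle\alpha,A\alpha\rangle+\int_{\mathbb R^d}\big(e^{\langle\alpha,x\rangle}-1-\langle\alpha,x\rangle\mathbf 1_{[0,1]}(|x|)\big)\,\nu(dx)\Big).$$ -/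

import Mathlib

open MeasureTheory ProbabilityTheory Topology
open scoped ENNReal RealInnerProductSpace Matrix

noncomputable section

/-! ### Infinitely divisible and quasi-infinitely divisible distributions -/

/-- The `n`-fold convolution of `ρ` with itself (the Dirac measure at the origin for `n = 0`). -/
def convPower {d : ℕ} (ρ : Measure (EuclideanSpace ℝ (Fin d))) :
    ℕ → Measure (EuclideanSpace ℝ (Fin d))
  | 0 => Measure.dirac 0
  | n + 1 => Measure.conv (convPower ρ n) ρ

/-- `μ` is infinitely divisible: a probability measure which for every `n ≥ 1` is the `n`-fold
convolution of some probability measure. -/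
def IsInfinitelyDivisible {d : ℕ} (μ : Measure (EuclideanSpace ℝ (Fin d))) : Prop :=
  IsProbabilityMeasure μ ∧ ∀ n : ℕ, 1 ≤ n →
    ∃ ρ : Measure (EuclideanSpace ℝ (Fin d)), IsProbabilityMeasure ρ ∧ convPower ρ n = μ

/-- `μ` is quasi-infinitely divisible: a probability measure whose characteristic function is the
quotient of the characteristic functions of two infinitely divisible distributions (these have no
zeros, so no division by zero occurs). -/
def IsQuasiInfinitelyDivisible {d : ℕ} (μ : Measure (EuclideanSpace ℝ (Fin d))) : Prop :=
  IsProbabilityMeasure μ ∧ ∃ μ₁ μ₂ : Measure (EuclideanSpace ℝ (Fin d)),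
    IsInfinitelyDivisible μ₁ ∧ IsInfinitelyDivisible μ₂ ∧
      ∀ z, charFun μ z = charFun μ₁ z / charFun μ₂ z

/-! ### Quasi-Lévy type measures -/

/-- The set `{x : |x| ≥ r}`. -/
def outside (d : ℕ) (r : ℝ) : Set (EuclideanSpace ℝ (Fin d)) := {x | r ≤ ‖x‖}

lemma measurableSet_outside (d : ℕ) (r : ℝ) : MeasurableSet (outside d r) :=
  measurableSet_le measurable_const measurable_norm

/-- The class of Borel subsets of `{x : |x| ≥ r}`. -/
def borelOutside (d : ℕ) (r : ℝ) : Set (Set (EuclideanSpace ℝ (Fin d))) :=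
  {B | MeasurableSet B ∧ B ⊆ outside d r}

/-- A real function `ν` on the class of the Borel sets that are bounded away from `0`, whose
restriction to the Borel subsets of `{x : |x| ≥ r}` is a finite (that is, real-valued) signed
measure for every `r > 0`. As for Mathlib's vector measures, the function is totalized by the
value `0` on all other sets. -/
structure PunctualSignedMeasure (d : ℕ) where
  /-- the underlying set function -/
  toFun : Set (EuclideanSpace ℝ (Fin d)) → ℝ
  eq_zero_of_notMem : ∀ B, (¬ ∃ r : ℝ, 0 < r ∧ B ∈ borelOutside d r) → toFun B = 0
  empty : toFun ∅ = 0
  hasSum_iUnion : ∀ r : ℝ, 0 < r → ∀ f : ℕ → Set (EuclideanSpace ℝ (Fin d)),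
    (∀ i, f i ∈ borelOutside d r) → Pairwise (Function.onFun Disjoint f) →
      HasSum (fun i => toFun (f i)) (toFun (⋃ i, f i))

namespace PunctualSignedMeasure

variable {d : ℕ} (ν : PunctualSignedMeasure d)

open Classical in
/-- The signed measure `B ↦ ν (B ∩ {x : |x| ≥ r})`, that is, the restriction of `ν` to the Borel
subsets of `{x : |x| ≥ r}`, regarded as a signed measure on the whole space. -/
def restr (r : ℝ) (hr : 0 < r) : SignedMeasure (EuclideanSpace ℝ (Fin d)) where
  measureOf' B := if MeasurableSet B then ν.toFun (B ∩ outside d r) else 0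
  empty' := by simp [ν.empty]
  not_measurable' B hB := by simp [hB]
  m_iUnion' f hf hd := by
    have h := ν.hasSum_iUnion r hr (fun i => f i ∩ outside d r)
      (fun i => ⟨(hf i).inter (measurableSet_outside d r), Set.inter_subset_right⟩)
      (fun i j hij => (hd hij).mono Set.inter_subset_left Set.inter_subset_left)
    simpa only [hf, MeasurableSet.iUnion hf, if_true, Set.iUnion_inter] using h

open Classical in
lemma restr_apply {r : ℝ} (hr : 0 < r) {B : Set (EuclideanSpace ℝ (Fin d))}
    (hB : B ∈ borelOutside d r) : ν.restr r hr B = ν.toFun B := by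
  change (if MeasurableSet B then ν.toFun (B ∩ outside d r) else 0) = ν.toFun B
  rw [if_pos hB.1, Set.inter_eq_left.2 hB.2]

/-- The Jordan decomposition of the restriction of `ν` to the Borel subsets of `{x : |x| ≥ r}`. -/
def jordan (r : ℝ) (hr : 0 < r) : JordanDecomposition (EuclideanSpace ℝ (Fin d)) :=
  (ν.restr r hr).toJordanDecomposition

/-- The spherical shell `{x ≠ 0 : n ≤ 1 / |x| < n + 1}`. -/
def shell (d n : ℕ) : Set (EuclideanSpace ℝ (Fin d)) := {x | x ≠ 0 ∧ ⌊‖x‖⁻¹⌋₊ = n}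

/-- The positive part `ν⁺`, glued from the positive parts of the restrictions of `ν`; see
`posPart_apply`, `posPart_singleton_zero` and `eq_posPart` for its characterization. -/
def posPart : Measure (EuclideanSpace ℝ (Fin d)) :=
  Measure.sum fun n : ℕ =>
    (ν.jordan (1 / ((n : ℝ) + 1)) Nat.one_div_pos_of_nat).posPart.restrict (shell d n)

/-- The negative part `ν⁻`, glued from the negative parts of the restrictions of `ν`; see
`negPart_apply`, `negPart_singleton_zero` and `eq_negPart` for its characterization. -/
def negPart : Measure (EuclideanSpace ℝ (Fin d)) :=
  Measure.sum fun n : ℕ =>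
    (ν.jordan (1 / ((n : ℝ) + 1)) Nat.one_div_pos_of_nat).negPart.restrict (shell d n)

/-! The positive and the negative part are the measures without mass at `0` that agree with the
parts of the Jordan decompositions on the Borel sets bounded away from `0`. -/

lemma shell_subset (n : ℕ) : shell d n ⊆ outside d (1 / ((n : ℝ) + 1)) := by
  rintro x ⟨hx, hn⟩
  have h1 : 0 < ‖x‖ := norm_pos_iff.2 hx
  have h2 : ‖x‖⁻¹ < (n : ℝ) + 1 := by
    have := Nat.lt_floor_add_one ‖x‖⁻¹
    rwa [hn] at this
  change 1 / ((n : ℝ) + 1) ≤ ‖x‖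
  rw [one_div]
  exact (inv_lt_of_inv_lt₀ h1 h2).le

lemma measurableSet_shell (n : ℕ) : MeasurableSet (shell d n) := by
  have h : Measurable fun x : EuclideanSpace ℝ (Fin d) => ⌊‖x‖⁻¹⌋₊ :=
    Nat.measurable_floor.comp measurable_norm.inv
  exact (measurableSet_singleton 0).compl.inter (h (measurableSet_singleton n))

open Classical in
lemma jordan_restrict {r s : ℝ} (hs : 0 < s) (hsr : s ≤ r) :
    (ν.jordan s hs).posPart.restrict (outside d r) = (ν.jordan r (hs.trans_le hsr)).posPart ∧
    (ν.jordan s hs).negPart.restrict (outside d r) = (ν.jordan r (hs.trans_le hsr)).negPart := by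
  let j : JordanDecomposition (EuclideanSpace ℝ (Fin d)) :=
    { posPart := (ν.jordan s hs).posPart.restrict (outside d r)
      negPart := (ν.jordan s hs).negPart.restrict (outside d r)
      mutuallySingular :=
        (((ν.jordan s hs).mutuallySingular.restrict _).symm.restrict _).symm }
  have hj : ν.jordan r (hs.trans_le hsr) = j := by
    apply SignedMeasure.toJordanDecomposition_eq
    ext B hB
    have h1 : ν.restr s hs = (ν.jordan s hs).toSignedMeasure :=
      (SignedMeasure.toSignedMeasure_toJordanDecomposition _).symm
    have hBr : B ∩ outside d r ∈ borelOutside d r :=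
      ⟨hB.inter (measurableSet_outside d r), Set.inter_subset_right⟩
    have hBs : B ∩ outside d r ∈ borelOutside d s :=
      ⟨hBr.1, fun x hx => hsr.trans hx.2⟩
    have h2 : ν.restr r (hs.trans_le hsr) B = ν.toFun (B ∩ outside d r) := if_pos hB
    rw [h2, ← ν.restr_apply hs hBs, h1]
    simp only [JordanDecomposition.toSignedMeasure, j]
    rw [Measure.toSignedMeasure_sub_apply hBs.1, Measure.toSignedMeasure_sub_apply hB,
      measureReal_restrict_apply hB, measureReal_restrict_apply hB]
  rw [hj]
  exact ⟨rfl, rfl⟩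

lemma jordan_apply_eq {r s : ℝ} (hr : 0 < r) (hs : 0 < s) {B : Set (EuclideanSpace ℝ (Fin d))}
    (hBr : B ∈ borelOutside d r) (hBs : B ⊆ outside d s) :
    (ν.jordan s hs).posPart B = (ν.jordan r hr).posPart B ∧
    (ν.jordan s hs).negPart B = (ν.jordan r hr).negPart B := by
  have key : ∀ {r s : ℝ} (hr : 0 < r) (hs : 0 < s), s ≤ r → MeasurableSet B → B ⊆ outside d r →
      (ν.jordan s hs).posPart B = (ν.jordan r hr).posPart B ∧
      (ν.jordan s hs).negPart B = (ν.jordan r hr).negPart B := by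
    intro r s hr hs hsr hB hBr
    obtain ⟨h1, h2⟩ := ν.jordan_restrict hs hsr
    rw [← h1, ← h2, Measure.restrict_apply hB, Measure.restrict_apply hB,
      Set.inter_eq_left.2 hBr]
    exact ⟨rfl, rfl⟩
  rcases le_total s r with h | h
  · exact key hr hs h hBr.1 hBr.2
  · exact ⟨(key hs hr h hBr.1 hBs).1.symm, (key hs hr h hBr.1 hBs).2.symm⟩

lemma measure_eq_tsum_shell (ρ : Measure (EuclideanSpace ℝ (Fin d)))
    {B : Set (EuclideanSpace ℝ (Fin d))} (hB : MeasurableSet B) (h0 : (0 : _) ∉ B) :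
    ρ B = ∑' n : ℕ, ρ (B ∩ shell d n) := by
  rw [← measure_iUnion]
  · congr 1
    ext x
    simp only [Set.mem_iUnion, Set.mem_inter_iff, shell, Set.mem_ofPred_eq]
    constructor
    · intro hx
      exact ⟨_, hx, fun h => h0 (h ▸ hx), rfl⟩
    · rintro ⟨_, hx, _⟩
      exact hx
  · intro m n hmn
    refine Set.disjoint_left.2 fun x hx hx' => hmn ?_
    rw [← hx.2.2, hx'.2.2]
  · exact fun n => hB.inter (measurableSet_shell n)

lemma zero_notMem_of_mem {r : ℝ} (hr : 0 < r) {B : Set (EuclideanSpace ℝ (Fin d))}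
    (hB : B ∈ borelOutside d r) : (0 : EuclideanSpace ℝ (Fin d)) ∉ B := by
  intro h
  have : r ≤ ‖(0 : EuclideanSpace ℝ (Fin d))‖ := hB.2 h
  rw [norm_zero] at this
  exact absurd hr this.not_gt

theorem posPart_apply {r : ℝ} (hr : 0 < r) {B : Set (EuclideanSpace ℝ (Fin d))}
    (hB : B ∈ borelOutside d r) : ν.posPart B = (ν.jordan r hr).posPart B := by
  rw [posPart, Measure.sum_apply _ hB.1,
    measure_eq_tsum_shell (ν.jordan r hr).posPart hB.1 (zero_notMem_of_mem hr hB)]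
  refine tsum_congr fun n => ?_
  rw [Measure.restrict_apply hB.1]
  exact (ν.jordan_apply_eq hr Nat.one_div_pos_of_nat
    ⟨hB.1.inter (measurableSet_shell n), fun x hx => hB.2 hx.1⟩
    (fun x hx => shell_subset n hx.2)).1

theorem negPart_apply {r : ℝ} (hr : 0 < r) {B : Set (EuclideanSpace ℝ (Fin d))}
    (hB : B ∈ borelOutside d r) : ν.negPart B = (ν.jordan r hr).negPart B := by
  rw [negPart, Measure.sum_apply _ hB.1,
    measure_eq_tsum_shell (ν.jordan r hr).negPart hB.1 (zero_notMem_of_mem hr hB)]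
  refine tsum_congr fun n => ?_
  rw [Measure.restrict_apply hB.1]
  exact (ν.jordan_apply_eq hr Nat.one_div_pos_of_nat
    ⟨hB.1.inter (measurableSet_shell n), fun x hx => hB.2 hx.1⟩
    (fun x hx => shell_subset n hx.2)).2

lemma singleton_zero_inter_shell (n : ℕ) : ({0} : Set (EuclideanSpace ℝ (Fin d))) ∩ shell d n = ∅ := by
  ext x
  simp only [shell, Set.mem_inter_iff, Set.mem_singleton_iff, Set.mem_ofPred_eq,
    Set.mem_empty_iff_false, iff_false]
  tauto

theorem posPart_singleton_zero : ν.posPart {0} = 0 := by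
  rw [posPart, Measure.sum_apply _ (measurableSet_singleton _)]
  simp [Measure.restrict_apply, singleton_zero_inter_shell]

theorem negPart_singleton_zero : ν.negPart {0} = 0 := by
  rw [negPart, Measure.sum_apply _ (measurableSet_singleton _)]
  simp [Measure.restrict_apply, singleton_zero_inter_shell]

lemma eq_of_eq_outside {ρ ρ' : Measure (EuclideanSpace ℝ (Fin d))} (h0 : ρ {0} = 0)
    (h0' : ρ' {0} = 0)
    (h : ∀ r : ℝ, 0 < r → ∀ B ∈ borelOutside d r, ρ B = ρ' B) : ρ = ρ' := by
  ext B hB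
  have hz : ∀ {τ : Measure (EuclideanSpace ℝ (Fin d))}, τ {0} = 0 → τ B = τ (B \ {0}) :=
    fun hτ => (measure_sdiff_null hτ).symm
  rw [hz h0, hz h0', measure_eq_tsum_shell ρ (hB.diff (measurableSet_singleton 0)) (by simp),
    measure_eq_tsum_shell ρ' (hB.diff (measurableSet_singleton 0)) (by simp)]
  refine tsum_congr fun n => h (1 / ((n : ℝ) + 1)) Nat.one_div_pos_of_nat _
    ⟨(hB.diff (measurableSet_singleton 0)).inter (measurableSet_shell n),
      fun x hx => shell_subset n hx.2⟩

theorem eq_posPart {ρ : Measure (EuclideanSpace ℝ (Fin d))} (h0 : ρ {0} = 0)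
    (h : ∀ (r : ℝ) (hr : 0 < r), ∀ B ∈ borelOutside d r, ρ B = (ν.jordan r hr).posPart B) :
    ρ = ν.posPart :=
  eq_of_eq_outside h0 ν.posPart_singleton_zero
    fun r hr B hB => (h r hr B hB).trans (ν.posPart_apply hr hB).symm

theorem eq_negPart {ρ : Measure (EuclideanSpace ℝ (Fin d))} (h0 : ρ {0} = 0)
    (h : ∀ (r : ℝ) (hr : 0 < r), ∀ B ∈ borelOutside d r, ρ B = (ν.jordan r hr).negPart B) :
    ρ = ν.negPart :=
  eq_of_eq_outside h0 ν.negPart_singleton_zero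
    fun r hr B hB => (h r hr B hB).trans (ν.negPart_apply hr hB).symm

/-! #### Integration with respect to `ν` -/

/-- `f` is integrable over `S` with respect to `ν`: it is so with respect to `ν⁺` and `ν⁻`. -/
def IntegrableOn {F : Type*} [NormedAddCommGroup F]
    (f : EuclideanSpace ℝ (Fin d) → F) (S : Set (EuclideanSpace ℝ (Fin d))) : Prop :=
  MeasureTheory.IntegrableOn f S ν.posPart ∧ MeasureTheory.IntegrableOn f S ν.negPart

/-- The integral of `f` over `S` with respect to `ν`, the difference of the integrals with respect
to `ν⁺` and `ν⁻`. -/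
def integralOn {F : Type*} [NormedAddCommGroup F] [NormedSpace ℝ F]
    (f : EuclideanSpace ℝ (Fin d) → F) (S : Set (EuclideanSpace ℝ (Fin d))) : F :=
  (∫ x in S, f x ∂ν.posPart) - ∫ x in S, f x ∂ν.negPart

/-- `ν` is a quasi-Lévy type measure: `x ↦ min 1 |x|²` is integrable with respect to `ν`. -/
def IsQuasiLevyType : Prop :=
  ν.IntegrableOn (fun x => min 1 (‖x‖ ^ 2)) Set.univ

end PunctualSignedMeasure

/-! ### The Lévy-Khintchine representation -/

/-- The value `⟨z, A z⟩` of the quadratic form of the matrix `A`. -/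
def quadForm {d : ℕ} (A : Matrix (Fin d) (Fin d) ℝ) (z : EuclideanSpace ℝ (Fin d)) : ℝ :=
  ⟪z, Matrix.toEuclideanLin A z⟫

/-- The indicator of `|x| ≤ 1`. -/
def unitBallInd {d : ℕ} (x : EuclideanSpace ℝ (Fin d)) : ℝ :=
  (Metric.closedBall (0 : EuclideanSpace ℝ (Fin d)) 1).indicator (fun _ => (1 : ℝ)) x

/-- The quasi-infinitely divisible distribution `μ` has the standard characteristic triplet
`(A, ν, γ)`, where `A` is a symmetric real matrix, `ν` is a quasi-Lévy type measure and `γ` is a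
vector: the characteristic function of `μ` has the Lévy-Khintchine representation
`exp (i⟨γ, z⟩ - ⟨z, A z⟩ / 2 + ∫ (exp (i⟨z, x⟩) - 1 - i⟨z, x⟩ 1_{|x| ≤ 1}) ν(dx))`. -/
structure HasStandardTriplet {d : ℕ} (μ : Measure (EuclideanSpace ℝ (Fin d)))
    (A : Matrix (Fin d) (Fin d) ℝ) (ν : PunctualSignedMeasure d)
    (γ : EuclideanSpace ℝ (Fin d)) : Prop where
  qid : IsQuasiInfinitelyDivisible μ
  symm : A.IsSymm
  quasiLevy : ν.IsQuasiLevyType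
  charFun_eq : ∀ z : EuclideanSpace ℝ (Fin d), charFun μ z = Complex.exp
    ((⟪γ, z⟫ : ℝ) * Complex.I - (quadForm A z : ℝ) / 2 +
      ν.integralOn (fun x => Complex.exp ((⟪z, x⟫ : ℝ) * Complex.I) - 1 -
        (⟪z, x⟫ * unitBallInd x : ℝ) * Complex.I) Set.univ)

/-- `m` is the center of the quasi-infinitely divisible distribution `μ` with Gaussian covariance
matrix `A` and quasi-Lévy measure `ν`: the function `|x|` is `ν`-integrable over `|x| > 1`, and `m`
is the location vector in the representation of the characteristic function of `μ` as
`exp (i⟨m, z⟩ - ⟨z, A z⟩ / 2 + ∫ (exp (i⟨z, x⟩) - 1 - i⟨z, x⟩) ν(dx))`. -/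
structure IsCenter {d : ℕ} (μ : Measure (EuclideanSpace ℝ (Fin d)))
    (A : Matrix (Fin d) (Fin d) ℝ) (ν : PunctualSignedMeasure d)
    (m : EuclideanSpace ℝ (Fin d)) : Prop where
  integrable : ν.IntegrableOn (fun x => ‖x‖) {x | 1 < ‖x‖}
  charFun_eq : ∀ z : EuclideanSpace ℝ (Fin d), charFun μ z = Complex.exp
    ((⟪m, z⟫ : ℝ) * Complex.I - (quadForm A z : ℝ) / 2 +
      ν.integralOn (fun x => Complex.exp ((⟪z, x⟫ : ℝ) * Complex.I) - 1 -
        (⟪z, x⟫ : ℝ) * Complex.I) Set.univ)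

/-! ### Moments -/

/-- `h` is submultiplicative: nonnegative, and `h (x + y) ≤ C h(x) h(y)` for some `C > 0`. -/
def IsSubmultiplicative {d : ℕ} (h : EuclideanSpace ℝ (Fin d) → ℝ) : Prop :=
  (∀ x, 0 ≤ h x) ∧ ∃ C : ℝ, 0 < C ∧ ∀ x y, h (x + y) ≤ C * h x * h y

/-- `h` is locally bounded: every point has a neighbourhood on which `h` is bounded. -/
def IsLocallyBounded {d : ℕ} (h : EuclideanSpace ℝ (Fin d) → ℝ) : Prop :=
  ∀ x, ∃ M : ℝ, ∀ᶠ y in 𝓝 x, |h y| ≤ M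

/-- `∫_S h dρ < ∞` for a nonnegative function `h`. -/
def FiniteMomentOn {d : ℕ} (h : EuclideanSpace ℝ (Fin d) → ℝ)
    (S : Set (EuclideanSpace ℝ (Fin d))) (ρ : Measure (EuclideanSpace ℝ (Fin d))) : Prop :=
  ∫⁻ x in S, ENNReal.ofReal (h x) ∂ρ < ∞

/-- The covariance matrix of the random vector `X`. -/
def covarianceMatrix {d : ℕ} {Ω : Type*} [MeasurableSpace Ω]
    (X : Ω → EuclideanSpace ℝ (Fin d)) (P : Measure Ω) : Matrix (Fin d) (Fin d) ℝ :=
  Matrix.of fun i j => covariance (fun ω => X ω i) (fun ω => X ω j) P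

/-- The matrix `∫ x xᵀ ν(dx)`, the integral being taken entrywise. -/
def secondMomentMatrix {d : ℕ} (ν : PunctualSignedMeasure d) : Matrix (Fin d) (Fin d) ℝ :=
  Matrix.of fun i j => ν.integralOn (fun x => x i * x j) Set.univ

end

/-! ### Submultiplicative moments of convolutions and of compound Poisson distributions. -/

noncomputable section

/-! ### Submultiplicative moments and convolutions -/

section Convolution

variable {d : ℕ} {h : EuclideanSpace ℝ (Fin d) → ℝ}

/-! The signed exponent is undone by convolution. For a suitable `c ≥ 0` both `A + c • 1` and `c •
1` are positive semidefinite. Let `L₁`, `L₂` be laws with triplets `(0, ν⁺, 0)` and `(0, ν⁻, 0)`.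
Comparing characteristic functions gives `μ ∗ (N(0, c • 1) ∗ L₂) = N(γ, A + c • 1) ∗ L₁`
(`HasStandardTriplet.exists_conv_eq`), an identity between probability measures in which no sign is
left.

A submultiplicative moment of a convolution is finite exactly when it is finite for both factors
(`lintegral_conv_lt_top_iff`). Locally bounded submultiplicative functions grow at most
exponentially, so Gaussian factors never matter. A law with Lévy measure `p` is the convolution of a
small-jump law, all of whose exponential moments are finite (`exists_compensated`), and a compound
Poisson law with jumps from `p` on `{|x| > 1}`, whose moments are finite exactly when those of the
jump measure are (`lintegral_compoundPoisson_lt_top_iff`). Hence the equivalence for `h`. Since `exp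
⟪α, ·⟫` is multiplicative, integrating it against the identity gives the exponential moment by
division.

For the first two moments, the equivalence is applied to `1 + |x|` and its square. The values come
from expanding `t ↦ charFun μ (t • z)` at `0` in two ways, from the moments of `μ` and from the
exponent (`IsCenter.integral_eq`, `IsCenter.integral_inner_sq`); polarization yields the matrix
entries. -/

lemma measurable_ofReal_comp (hm : Measurable h) : Measurable fun x => ENNReal.ofReal (h x) :=
  ENNReal.measurable_ofReal.comp hm

lemma measurable_ofReal_exp_inner (α : EuclideanSpace ℝ (Fin d)) :
    Measurable fun x : EuclideanSpace ℝ (Fin d) => ENNReal.ofReal (Real.exp ⟪α, x⟫) := by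
  fun_prop

lemma IsSubmultiplicative.exists_ofReal_le (hs : IsSubmultiplicative h) :
    ∃ C : ℝ≥0∞, C ≠ ∞ ∧ ∀ x y,
      ENNReal.ofReal (h (x + y)) ≤ C * ENNReal.ofReal (h x) * ENNReal.ofReal (h y) := by
  obtain ⟨h0, C, hC, hsub⟩ := hs
  refine ⟨ENNReal.ofReal C, ENNReal.ofReal_ne_top, fun x y => ?_⟩
  rw [← ENNReal.ofReal_mul hC.le, ← ENNReal.ofReal_mul (mul_nonneg hC.le (h0 x))]
  exact ENNReal.ofReal_le_ofReal (hsub x y)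

lemma lintegral_conv_le {C : ℝ≥0∞} (hm : Measurable h)
    (hC : ∀ x y, ENNReal.ofReal (h (x + y)) ≤ C * ENNReal.ofReal (h x) * ENNReal.ofReal (h y))
    (P Q : Measure (EuclideanSpace ℝ (Fin d))) [SFinite Q] :
    ∫⁻ x, ENNReal.ofReal (h x) ∂(P ∗ Q) ≤
      C * (∫⁻ x, ENNReal.ofReal (h x) ∂P) * ∫⁻ x, ENNReal.ofReal (h x) ∂Q := by
  have hm' := measurable_ofReal_comp hm
  rw [Measure.lintegral_conv hm']
  calc ∫⁻ x, ∫⁻ y, ENNReal.ofReal (h (x + y)) ∂Q ∂P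
      ≤ ∫⁻ x, ∫⁻ y, C * ENNReal.ofReal (h x) * ENNReal.ofReal (h y) ∂Q ∂P :=
        lintegral_mono fun x => lintegral_mono fun y => hC x y
    _ = _ := by
        simp_rw [lintegral_const_mul _ hm']
        rw [lintegral_mul_const _ (hm'.const_mul C), lintegral_const_mul _ hm']

/-- By Tonelli, the moment of `Q` shifted by `x` is finite for `P`-almost every `x`, and such an `x`
exists because `P ≠ 0`. Submultiplicativity with the factor `h (-x)` undoes the shift. -/
lemma lintegral_lt_top_of_conv_left (hs : IsSubmultiplicative h) (hm : Measurable h)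
    (P Q : Measure (EuclideanSpace ℝ (Fin d))) [SFinite Q] [NeZero P]
    (hPQ : ∫⁻ x, ENNReal.ofReal (h x) ∂(P ∗ Q) < ∞) :
    ∫⁻ x, ENNReal.ofReal (h x) ∂Q < ∞ := by
  obtain ⟨C, hCt, hC⟩ := hs.exists_ofReal_le
  have hm' := measurable_ofReal_comp hm
  rw [Measure.lintegral_conv hm'] at hPQ
  have hmeas : Measurable fun x => ∫⁻ y, ENNReal.ofReal (h (x + y)) ∂Q :=
    Measurable.lintegral_prod_right (by fun_prop)
  obtain ⟨x, hx⟩ := (ae_lt_top hmeas hPQ.ne).exists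
  calc ∫⁻ y, ENNReal.ofReal (h y) ∂Q
      ≤ ∫⁻ y, C * ENNReal.ofReal (h (-x)) * ENNReal.ofReal (h (x + y)) ∂Q :=
        lintegral_mono fun y => by simpa using hC (-x) (x + y)
    _ = C * ENNReal.ofReal (h (-x)) * ∫⁻ y, ENNReal.ofReal (h (x + y)) ∂Q :=
        lintegral_const_mul _ (hm'.comp (measurable_const_add x))
    _ < ∞ := ENNReal.mul_lt_top (ENNReal.mul_lt_top hCt.lt_top ENNReal.ofReal_lt_top) hx

/-- A submultiplicative moment of a convolution of probability measures is finite if and only if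
it is finite for both factors. -/
theorem lintegral_conv_lt_top_iff (hs : IsSubmultiplicative h) (hm : Measurable h)
    (P Q : Measure (EuclideanSpace ℝ (Fin d))) [IsProbabilityMeasure P] [IsProbabilityMeasure Q] :
    ∫⁻ x, ENNReal.ofReal (h x) ∂(P ∗ Q) < ∞ ↔
      ∫⁻ x, ENNReal.ofReal (h x) ∂P < ∞ ∧ ∫⁻ x, ENNReal.ofReal (h x) ∂Q < ∞ := by
  refine ⟨fun hPQ => ⟨?_, lintegral_lt_top_of_conv_left hs hm P Q hPQ⟩, fun ⟨hP, hQ⟩ => ?_⟩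
  · rw [Measure.conv_comm] at hPQ
    exact lintegral_lt_top_of_conv_left hs hm Q P hPQ
  · obtain ⟨C, hCt, hC⟩ := hs.exists_ofReal_le
    exact (lintegral_conv_le hm hC P Q).trans_lt
      (ENNReal.mul_lt_top (ENNReal.mul_lt_top hCt.lt_top hP) hQ)

lemma lintegral_exp_inner_conv (α : EuclideanSpace ℝ (Fin d))
    (P Q : Measure (EuclideanSpace ℝ (Fin d))) [SFinite Q] :
    ∫⁻ x, ENNReal.ofReal (Real.exp ⟪α, x⟫) ∂(P ∗ Q) =
      (∫⁻ x, ENNReal.ofReal (Real.exp ⟪α, x⟫) ∂P) *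
        ∫⁻ x, ENNReal.ofReal (Real.exp ⟪α, x⟫) ∂Q := by
  rw [Measure.lintegral_conv (measurable_ofReal_exp_inner α)]
  simp_rw [inner_add_right, Real.exp_add, ENNReal.ofReal_mul (Real.exp_pos _).le]
  simp_rw [lintegral_const_mul _ (measurable_ofReal_exp_inner α)]
  rw [lintegral_mul_const _ (measurable_ofReal_exp_inner α)]

end Convolution

/-! ### Growth of submultiplicative functions -/

section Growth

variable {d : ℕ} {h : EuclideanSpace ℝ (Fin d) → ℝ}

lemma IsLocallyBounded.exists_bound_closedBall (hb : IsLocallyBounded h) (r : ℝ) :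
    ∃ M : ℝ, 0 < M ∧ ∀ x, ‖x‖ ≤ r → h x ≤ M := by
  have key : ∃ M : ℝ, ∀ x ∈ Metric.closedBall (0 : EuclideanSpace ℝ (Fin d)) r, h x ≤ M := by
    refine (isCompact_closedBall (0 : EuclideanSpace ℝ (Fin d)) r).induction_on
      (p := fun s => ∃ M : ℝ, ∀ x ∈ s, h x ≤ M) ⟨0, by simp⟩
      (fun s t hst ⟨M, hM⟩ => ⟨M, fun x hx => hM x (hst hx)⟩) ?_ ?_
    · rintro s t ⟨M, hM⟩ ⟨N, hN⟩
      refine ⟨max M N, fun x hx => ?_⟩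
      rcases hx with hx | hx
      · exact (hM x hx).trans (le_max_left _ _)
      · exact (hN x hx).trans (le_max_right _ _)
    · intro x _
      obtain ⟨M, hM⟩ := hb x
      exact ⟨_, mem_nhdsWithin_of_mem_nhds hM, M, fun y hy => (le_abs_self _).trans hy⟩
  obtain ⟨M, hM⟩ := key
  exact ⟨max M 1, by positivity, fun x hx => (hM x (by simpa using hx)).trans (le_max_left _ _)⟩

/-- A locally bounded submultiplicative function grows at most exponentially. -/
theorem IsSubmultiplicative.exists_le_exp (hs : IsSubmultiplicative h) (hb : IsLocallyBounded h) :
    ∃ a b : ℝ, 0 ≤ b ∧ ∀ x, h x ≤ a * Real.exp (b * ‖x‖) := by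
  obtain ⟨h0, C, hC, hsub⟩ := hs
  obtain ⟨M, hM0, hM⟩ := hb.exists_bound_closedBall 1
  -- `C * M` is the cost of adding one step of length at most `1`; the lower bound `1` makes `B ^ n`
  -- monotone in `n` and `log B` nonnegative.
  set B := max 1 (C * M) with hB
  have hB1 : 1 ≤ B := le_max_left _ _
  have step : ∀ n : ℕ, ∀ x, ‖x‖ ≤ n + 1 → h x ≤ M * B ^ n := by
    intro n
    induction n with
    | zero => intro x hx; simpa using hM x (by simpa using hx)
    | succ n ih =>
      intro x hx
      push_cast at hx
      have hn : (0 : ℝ) < n + 1 + 1 := by positivity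
      -- A vector of norm at most `n + 2` is cut along its own ray into pieces of norm at most `1`
      -- and `n + 1`.
      have e : x = (1 / ((n : ℝ) + 1 + 1)) • x + (((n : ℝ) + 1) / (n + 1 + 1)) • x := by
        rw [← add_smul, ← add_div, add_comm 1 ((n : ℝ) + 1), div_self hn.ne', one_smul]
      have e1 : ‖(1 / ((n : ℝ) + 1 + 1)) • x‖ ≤ 1 := by
        rw [norm_smul, Real.norm_of_nonneg (by positivity), one_div_mul_eq_div, div_le_one hn]
        exact hx
      have e2 : ‖(((n : ℝ) + 1) / (n + 1 + 1)) • x‖ ≤ n + 1 := by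
        rw [norm_smul, Real.norm_of_nonneg (by positivity), div_mul_eq_mul_div, div_le_iff₀ hn]
        gcongr
      rw [e]
      calc _ ≤ C * h ((1 / ((n : ℝ) + 1 + 1)) • x) * h ((((n : ℝ) + 1) / (n + 1 + 1)) • x) :=
            hsub _ _
        _ ≤ C * M * (M * B ^ n) := by
            gcongr
            · exact h0 _
            · exact hM _ e1
            · exact ih _ e2
        _ ≤ B * (M * B ^ n) := by gcongr; exact le_max_right _ _
        _ = M * B ^ (n + 1) := by ring
  refine ⟨M, Real.log B, Real.log_nonneg hB1, fun x => ?_⟩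
  refine (step ⌊‖x‖⌋₊ x (Nat.lt_floor_add_one ‖x‖).le).trans ?_
  gcongr
  rw [← Real.rpow_natCast, Real.rpow_def_of_pos (by positivity)]
  gcongr
  · exact Real.log_nonneg hB1
  · exact Nat.floor_le (norm_nonneg x)

/-- Replaces the norm in the exponent by finitely many linear functionals: `‖x‖ ≤ d * |x i|` for the
coordinate `i` of largest modulus, and one of the two signs turns `|x i|` into a linear form. The
summand `1` covers `d = 0`. -/
lemma exp_mul_norm_le (b : ℝ) (hb : 0 ≤ b) (x : EuclideanSpace ℝ (Fin d)) :
    Real.exp (b * ‖x‖) ≤ 1 + ∑ i : Fin d,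
      (Real.exp ⟪EuclideanSpace.single i (b * d), x⟫ +
        Real.exp ⟪EuclideanSpace.single i (-(b * d)), x⟫) := by
  rcases Nat.eq_zero_or_pos d with rfl | hd
  · simp [Subsingleton.elim x 0]
  have : Nonempty (Fin d) := ⟨⟨0, hd⟩⟩
  obtain ⟨i, -, hi⟩ := Finset.exists_max_image Finset.univ (fun i => |x i|) Finset.univ_nonempty
  have h1 : ‖x‖ ≤ d * |x i| := by
    have hx : ‖x‖ ≤ ∑ j, |x j| := by
      have e : x = ∑ j, EuclideanSpace.single j (x j) := by
        ext k
        simp [Pi.single_apply]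
      calc ‖x‖ = ‖∑ j, EuclideanSpace.single j (x j)‖ := by rw [← e]
        _ ≤ ∑ j, ‖EuclideanSpace.single j (x j)‖ := norm_sum_le _ _
        _ = ∑ j, |x j| := by simp
    refine hx.trans ((Finset.sum_le_sum fun j hj => hi j hj).trans ?_)
    simp
  have h2 : Real.exp (b * ‖x‖) ≤ Real.exp ⟪EuclideanSpace.single i (b * d), x⟫ +
      Real.exp ⟪EuclideanSpace.single i (-(b * d)), x⟫ := by
    have h3 : Real.exp (b * ‖x‖) ≤ Real.exp (b * d * |x i|) := by
      rw [Real.exp_le_exp, mul_assoc]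
      gcongr
    refine h3.trans ?_
    have e1 : ⟪EuclideanSpace.single i (b * d), x⟫ = b * d * x i := by
      simp [EuclideanSpace.inner_single_left]
    have e2 : ⟪EuclideanSpace.single i (-(b * d)), x⟫ = -(b * d) * x i := by
      simp [EuclideanSpace.inner_single_left]
    rw [e1, e2]
    rcases abs_cases (x i) with ⟨h, _⟩ | ⟨h, _⟩
    · rw [h]; linarith [Real.exp_pos (-(b * d) * x i)]
    · rw [h, mul_neg, neg_mul]; linarith [Real.exp_pos (b * d * x i)]
  have h4 := Finset.single_le_sum (f := fun i : Fin d =>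
      Real.exp ⟪EuclideanSpace.single i (b * d), x⟫ +
        Real.exp ⟪EuclideanSpace.single i (-(b * d)), x⟫)
    (fun j _ => by positivity) (Finset.mem_univ i)
  linarith

/-- A probability measure all of whose exponential moments are finite has finite moments with
respect to all locally bounded submultiplicative functions. -/
theorem IsSubmultiplicative.lintegral_lt_top (hs : IsSubmultiplicative h)
    (hb : IsLocallyBounded h) (P : Measure (EuclideanSpace ℝ (Fin d))) [IsFiniteMeasure P]
    (hP : ∀ α : EuclideanSpace ℝ (Fin d), ∫⁻ x, ENNReal.ofReal (Real.exp ⟪α, x⟫) ∂P < ∞) :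
    ∫⁻ x, ENNReal.ofReal (h x) ∂P < ∞ := by
  obtain ⟨a, b, hb0, hab⟩ := hs.exists_le_exp hb
  have ha : 0 ≤ a := by
    by_contra! ha
    have := (hs.1 0).trans (hab 0)
    simp at this
    linarith
  have hexp : ∀ α : EuclideanSpace ℝ (Fin d), Integrable (fun x => Real.exp ⟪α, x⟫) P :=
    fun α => ⟨by fun_prop, by
      rw [hasFiniteIntegral_iff_ofReal (.of_forall fun _ => (Real.exp_pos _).le)]; exact hP α⟩
  have hint : Integrable (fun x => a * (1 + ∑ i : Fin d,
      (Real.exp ⟪EuclideanSpace.single i (b * d), x⟫ +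
        Real.exp ⟪EuclideanSpace.single i (-(b * d)), x⟫))) P :=
    ((integrable_const 1).add (integrable_finsetSum _ fun i _ =>
      (hexp _).add (hexp _))).const_mul a
  refine lt_of_le_of_lt (lintegral_mono fun x => ENNReal.ofReal_le_ofReal
    ((hab x).trans (mul_le_mul_of_nonneg_left (exp_mul_norm_le b hb0 x) ha))) ?_
  exact (hasFiniteIntegral_iff_ofReal (.of_forall fun x => by positivity)).1 hint.2

end Growth

/-! ### Compound Poisson distributions -/

section CompoundPoisson

variable {d : ℕ} (ρ : Measure (EuclideanSpace ℝ (Fin d)))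

instance isFiniteMeasure_convPower [IsFiniteMeasure ρ] (k : ℕ) :
    IsFiniteMeasure (convPower ρ k) := by
  induction k with
  | zero => exact inferInstanceAs (IsFiniteMeasure (Measure.dirac 0))
  | succ k ih => exact inferInstanceAs (IsFiniteMeasure (convPower ρ k ∗ ρ))

lemma charFun_convPower [IsFiniteMeasure ρ] (k : ℕ) (z : EuclideanSpace ℝ (Fin d)) :
    charFun (convPower ρ k) z = charFun ρ z ^ k := by
  induction k with
  | zero => simp [convPower]
  | succ k ih => rw [convPower, charFun_conv, ih, pow_succ]

lemma lintegral_exp_inner_convPower [IsFiniteMeasure ρ] (k : ℕ) (α : EuclideanSpace ℝ (Fin d)) :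
    ∫⁻ x, ENNReal.ofReal (Real.exp ⟪α, x⟫) ∂(convPower ρ k) =
      (∫⁻ x, ENNReal.ofReal (Real.exp ⟪α, x⟫) ∂ρ) ^ k := by
  induction k with
  | zero => simp [convPower, lintegral_dirac' _ (measurable_ofReal_exp_inner α)]
  | succ k ih => rw [convPower, lintegral_exp_inner_conv, ih, pow_succ]

/-- The compound Poisson distribution with jump measure `ρ`. -/
def compoundPoisson : Measure (EuclideanSpace ℝ (Fin d)) :=
  Measure.sum fun k : ℕ =>
    ENNReal.ofReal (Real.exp (-ρ.real Set.univ) / k.factorial) • convPower ρ k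

lemma hasSum_exp_neg_div_factorial (c x : ℝ) :
    HasSum (fun k : ℕ => Real.exp (-c) / k.factorial * x ^ k) (Real.exp (x - c)) := by
  have h := (NormedSpace.expSeries_div_hasSum_exp (𝔸 := ℝ) x).mul_left (Real.exp (-c))
  rw [← Real.exp_eq_exp_ℝ] at h
  convert! h using 1
  · ext k; ring
  · rw [← Real.exp_add]; ring_nf

/-- The `k`-fold convolution has moment `m ^ k`, so the Poisson weights sum up to an exponential
series. -/
lemma lintegral_exp_inner_compoundPoisson [IsFiniteMeasure ρ] (α : EuclideanSpace ℝ (Fin d))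
    (hα : Integrable (fun x => Real.exp ⟪α, x⟫) ρ) :
    ∫⁻ x, ENNReal.ofReal (Real.exp ⟪α, x⟫) ∂(compoundPoisson ρ) =
      ENNReal.ofReal (Real.exp (∫ x, (Real.exp ⟪α, x⟫ - 1) ∂ρ)) := by
  rw [integral_sub hα (integrable_const _), compoundPoisson, lintegral_sum_measure]
  simp_rw [lintegral_smul_measure, lintegral_exp_inner_convPower,
    ← ofReal_integral_eq_lintegral_ofReal hα (.of_forall fun _ => (Real.exp_pos _).le)]
  set m := ∫ x, Real.exp ⟪α, x⟫ ∂ρ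
  have hm : 0 ≤ m := integral_nonneg fun x => (Real.exp_pos _).le
  have h := hasSum_exp_neg_div_factorial (ρ.real Set.univ) m
  simp only [integral_const, smul_eq_mul, mul_one]
  rw [← h.tsum_eq, ENNReal.ofReal_tsum_of_nonneg (fun k => by positivity) h.summable]
  refine tsum_congr fun k => ?_
  rw [ENNReal.ofReal_mul (by positivity), ENNReal.ofReal_pow hm]

instance isProbabilityMeasure_compoundPoisson [IsFiniteMeasure ρ] :
    IsProbabilityMeasure (compoundPoisson ρ) := by
  -- At `α = 0` the exponential moment is the total mass.
  have h := lintegral_exp_inner_compoundPoisson ρ 0 (by simp)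
  simp only [inner_zero_left, Real.exp_zero, ENNReal.ofReal_one, sub_self,
    integral_zero, lintegral_const, one_mul] at h
  exact ⟨h⟩

lemma charFun_compoundPoisson [IsFiniteMeasure ρ] (z : EuclideanSpace ℝ (Fin d)) :
    charFun (compoundPoisson ρ) z =
      Complex.exp (∫ x, (Complex.exp ((⟪z, x⟫ : ℝ) * Complex.I) - 1) ∂ρ) := by
  have hi : ∀ (τ : Measure (EuclideanSpace ℝ (Fin d))) [IsFiniteMeasure τ],
      Integrable (fun x => Complex.exp ((⟪x, z⟫ : ℝ) * Complex.I)) τ := fun τ _ =>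
    (integrable_const (1 : ℝ)).mono (by fun_prop) (by simp [Complex.norm_exp_ofReal_mul_I])
  have h1 := hasSum_integral_measure (μ := fun k : ℕ =>
    ENNReal.ofReal (Real.exp (-ρ.real Set.univ) / k.factorial) • convPower ρ k)
    (hi (compoundPoisson ρ))
  have h2 := (NormedSpace.expSeries_div_hasSum_exp (𝔸 := ℂ) (charFun ρ z)).mul_left
    (Complex.exp (-(ρ.real Set.univ : ℝ)))
  rw [← Complex.exp_eq_exp_ℂ, ← Complex.exp_add] at h2
  have h3 : charFun (compoundPoisson ρ) z =
      Complex.exp (-(ρ.real Set.univ : ℝ) + charFun ρ z) := by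
    refine h1.unique ?_
    convert! h2 using 1
    ext k
    rw [integral_smul_measure, ENNReal.toReal_ofReal (by positivity), ← charFun_apply,
      charFun_convPower, Complex.real_smul]
    push_cast
    ring
  rw [h3]
  congr 1
  simp_rw [real_inner_comm _ z]
  rw [integral_sub (hi ρ) (integrable_const _), ← charFun_apply]
  simp
  ring

/-- A submultiplicative moment of a compound Poisson distribution is finite if and only if it is
finite for the jump measure. -/
theorem lintegral_compoundPoisson_lt_top_iff [IsFiniteMeasure ρ]
    {h : EuclideanSpace ℝ (Fin d) → ℝ} (hs : IsSubmultiplicative h) (hm : Measurable h) :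
    ∫⁻ x, ENNReal.ofReal (h x) ∂(compoundPoisson ρ) < ∞ ↔ ∫⁻ x, ENNReal.ofReal (h x) ∂ρ < ∞ := by
  have hm' := measurable_ofReal_comp hm
  rw [compoundPoisson, lintegral_sum_measure]
  simp_rw [lintegral_smul_measure]
  constructor
  · intro hfin
    -- The term `k = 1` is a positive multiple of the moment of `ρ` itself.
    have h1 := (ENNReal.le_tsum 1).trans_lt hfin
    have e : convPower ρ 1 = ρ := by simp [convPower]
    rw [e, smul_eq_mul] at h1
    exact ENNReal.lt_top_of_mul_ne_top_right h1.ne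
      (ENNReal.ofReal_pos.2 (by positivity)).ne'
  · intro hfin
    obtain ⟨C, hCt, hC⟩ := hs.exists_ofReal_le
    set C' := max C 1
    have hC1 : 1 ≤ C' := le_max_right _ _
    have hC' : ∀ x y, ENNReal.ofReal (h (x + y)) ≤
        C' * ENNReal.ofReal (h x) * ENNReal.ofReal (h y) := fun x y =>
      (hC x y).trans (by gcongr; exact le_max_left _ _)
    set m := ∫⁻ x, ENNReal.ofReal (h x) ∂ρ
    -- The moments of the convolution powers grow at most geometrically, which the factorials in the
    -- Poisson weights absorb. The factor `h 0` comes from the Dirac mass at `k = 0`.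
    have hpow : ∀ k, ∫⁻ x, ENNReal.ofReal (h x) ∂(convPower ρ k) ≤
        ENNReal.ofReal (h 0) * (C' * m) ^ k := by
      intro k
      induction k with
      | zero => simp [convPower, lintegral_dirac' _ hm']
      | succ k ih =>
        refine (lintegral_conv_le hm hC' _ _).trans ?_
        calc _ ≤ C' * (ENNReal.ofReal (h 0) * (C' * m) ^ k) * m := by gcongr
          _ = _ := by ring
    have hCm : C' * m < ∞ := ENNReal.mul_lt_top (max_lt hCt.lt_top ENNReal.one_lt_top) hfin
    obtain ⟨r, hr0, hr⟩ : ∃ r : ℝ, 0 ≤ r ∧ C' * m = ENNReal.ofReal r :=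
      ⟨(C' * m).toReal, ENNReal.toReal_nonneg, (ENNReal.ofReal_toReal hCm.ne).symm⟩
    have hsum := hasSum_exp_neg_div_factorial (ρ.real Set.univ) r
    calc _ ≤ ∑' k : ℕ, ENNReal.ofReal (h 0) *
          ENNReal.ofReal (Real.exp (-ρ.real Set.univ) / k.factorial * r ^ k) := by
          refine ENNReal.tsum_le_tsum fun k => ?_
          rw [ENNReal.ofReal_mul (by positivity), ENNReal.ofReal_pow hr0, ← hr, smul_eq_mul,
            mul_left_comm]
          gcongr
          exact hpow k
      _ < ∞ := by
          rw [ENNReal.tsum_mul_left, ← ENNReal.ofReal_tsum_of_nonneg (fun k => by positivity)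
            hsum.summable]
          exact ENNReal.mul_lt_top ENNReal.ofReal_lt_top ENNReal.ofReal_lt_top

end CompoundPoisson

end

/-! ### Laws with small jumps as weak limits, and their Laplace transforms. -/

noncomputable section

/-! ### Elementary estimates -/

section Estimates

/-- The quadratic bound serves small jumps, the linear one large jumps. For `|y| ≥ 1` the triangle
inequality gives `2 + |y| ≤ 3 * |y|`, whence the constant. -/
lemma norm_cexp_sub_one_sub_le_sq (y : ℝ) :
    ‖Complex.exp (y * Complex.I) - 1 - y * Complex.I‖ ≤ 3 * y ^ 2 ∧
    ‖Complex.exp (y * Complex.I) - 1 - y * Complex.I‖ ≤ 3 * |y| := by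
  have hn : ‖(y : ℂ) * Complex.I‖ = |y| := by simp
  rcases le_total |y| 1 with h | h
  · have h1 := Complex.norm_exp_sub_one_sub_id_le (x := (y : ℂ) * Complex.I) (by rwa [hn])
    rw [hn, sq_abs] at h1
    have h2 : y ^ 2 ≤ |y| := by rw [← sq_abs]; nlinarith [abs_nonneg y]
    constructor <;> nlinarith [abs_nonneg y, sq_nonneg y]
  · have h1 : ‖Complex.exp (y * Complex.I) - 1 - y * Complex.I‖ ≤ 1 + 1 + |y| := by
      refine (norm_sub_le _ _).trans (add_le_add ((norm_sub_le _ _).trans ?_) hn.le)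
      rw [Complex.norm_exp_ofReal_mul_I, norm_one]
    have h2 : |y| ≤ y ^ 2 := by rw [← sq_abs]; nlinarith
    constructor <;> linarith

lemma abs_exp_sub_one_sub_le (y : ℝ) :
    |Real.exp y - 1 - y| ≤ y ^ 2 * Real.exp |y| := by
  have h := Complex.norm_exp_sub_sum_le_norm_mul_exp (y : ℂ) 2
  have e : Complex.exp y - ∑ m ∈ Finset.range 2, (y : ℂ) ^ m / m.factorial =
      ((Real.exp y - 1 - y : ℝ) : ℂ) := by
    simp [Finset.sum_range_succ]; ring
  rwa [e, Complex.norm_real, Complex.norm_real, Real.norm_eq_abs, Real.norm_eq_abs, sq_abs] at h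

end Estimates

/-! ### Existence in Lévy's continuity theorem -/

/-- Continuity of the limit at `0` forces tightness, so a subsequence converges weakly; its limit
has characteristic function `f`, and then the whole sequence converges to it. -/
lemma exists_tendsto_of_tendsto_charFun {E : Type*} [NormedAddCommGroup E] [InnerProductSpace ℝ E]
    [FiniteDimensional ℝ E] [MeasurableSpace E] [BorelSpace E]
    (μ : ℕ → ProbabilityMeasure E) {f : E → ℂ} (hf : ContinuousAt f 0)
    (h : ∀ t, Filter.Tendsto (fun n => charFun (μ n : Measure E) t) Filter.atTop (𝓝 (f t))) :
    ∃ μ₀ : ProbabilityMeasure E, (∀ t, charFun (μ₀ : Measure E) t = f t) ∧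
      Filter.Tendsto μ Filter.atTop (𝓝 μ₀) := by
  have htight := isTightMeasureSet_of_tendsto_charFun hf h
  have hc : IsCompact (closure (Set.range μ)) := by
    refine isCompact_closure_of_isTightMeasureSet ?_
    convert! htight using 1
    ext; simp
  obtain ⟨μ₀, -, φ, hφ, hlim⟩ := hc.tendsto_subseq (x := μ) fun n => subset_closure ⟨n, rfl⟩
  have h0 : ∀ t, charFun (μ₀ : Measure E) t = f t := fun t =>
    tendsto_nhds_unique (ProbabilityMeasure.tendsto_iff_tendsto_charFun.1 hlim t)
      ((h t).comp hφ.tendsto_atTop)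
  refine ⟨μ₀, h0, ProbabilityMeasure.tendsto_of_tendsto_charFun fun t => ?_⟩
  rw [h0]
  exact h t

/-- Portmanteau on open sets. As `f` may be unbounded, mass can escape in the limit, so this
argument gives only an inequality. -/
lemma lintegral_le_of_tendsto {E : Type*} [MeasurableSpace E] [TopologicalSpace E]
    [OpensMeasurableSpace E] [HasOuterApproxClosed E] {μ : ℕ → ProbabilityMeasure E}
    {μ₀ : ProbabilityMeasure E} (h : Filter.Tendsto μ Filter.atTop (𝓝 μ₀)) {f : E → ℝ}
    (hf : Continuous f) (hf0 : ∀ x, 0 ≤ f x) {c : ℝ≥0∞}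
    (hc : Filter.Tendsto (fun n => ∫⁻ x, ENNReal.ofReal (f x) ∂(μ n)) Filter.atTop (𝓝 c)) :
    ∫⁻ x, ENNReal.ofReal (f x) ∂μ₀ ≤ c := by
  rw [← hc.liminf_eq]
  exact lintegral_le_liminf_lintegral_of_forall_isOpen_measure_le_liminf_measure hf hf0
    fun G hG => ProbabilityMeasure.le_liminf_measure_open_of_tendsto h hG

/-! ### Compensated compound Poisson distributions -/

section Compensated

variable {d : ℕ} (ρ : Measure (EuclideanSpace ℝ (Fin d)))

/-- The compound Poisson distribution with jump measure `ρ`, centered by its mean. -/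
def compensatedPoisson : Measure (EuclideanSpace ℝ (Fin d)) :=
  compoundPoisson ρ ∗ Measure.dirac (-∫ x, x ∂ρ)

instance isProbabilityMeasure_compensatedPoisson [IsFiniteMeasure ρ] :
    IsProbabilityMeasure (compensatedPoisson ρ) := by
  unfold compensatedPoisson; infer_instance

lemma integrable_cexp_inner_mul_I [IsFiniteMeasure ρ] (z : EuclideanSpace ℝ (Fin d)) :
    Integrable (fun x => Complex.exp ((⟪z, x⟫ : ℝ) * Complex.I)) ρ :=
  (integrable_const (1 : ℝ)).mono (by fun_prop) (by simp [Complex.norm_exp_ofReal_mul_I])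

lemma charFun_compensatedPoisson [IsFiniteMeasure ρ] (hρ : Integrable (fun x => x) ρ)
    (z : EuclideanSpace ℝ (Fin d)) :
    charFun (compensatedPoisson ρ) z =
      Complex.exp (∫ x, (Complex.exp ((⟪z, x⟫ : ℝ) * Complex.I) - 1 -
        (⟪z, x⟫ : ℝ) * Complex.I) ∂ρ) := by
  have h1 : Integrable (fun x => ((⟪z, x⟫ : ℝ) : ℂ) * Complex.I) ρ :=
    ((hρ.const_inner z).ofReal).mul_const _
  rw [integral_sub (f := fun x => Complex.exp ((⟪z, x⟫ : ℝ) * Complex.I) - 1)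
      ((integrable_cexp_inner_mul_I ρ z).sub (integrable_const _)) h1,
    compensatedPoisson, charFun_conv, charFun_compoundPoisson, charFun_dirac, ← Complex.exp_add,
    integral_mul_const, integral_complex_ofReal, integral_inner hρ, inner_neg_left,
    real_inner_comm z]
  congr 1
  push_cast
  ring

lemma lintegral_exp_inner_compensatedPoisson [IsFiniteMeasure ρ]
    (hρ : Integrable (fun x => x) ρ) (α : EuclideanSpace ℝ (Fin d))
    (hα : Integrable (fun x => Real.exp ⟪α, x⟫) ρ) :
    ∫⁻ x, ENNReal.ofReal (Real.exp ⟪α, x⟫) ∂(compensatedPoisson ρ) =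
      ENNReal.ofReal (Real.exp (∫ x, (Real.exp ⟪α, x⟫ - 1 - ⟪α, x⟫) ∂ρ)) := by
  rw [integral_sub (f := fun x => Real.exp ⟪α, x⟫ - 1) (hα.sub (integrable_const _))
      (hρ.const_inner α), integral_inner hρ,
    compensatedPoisson, lintegral_exp_inner_conv, lintegral_exp_inner_compoundPoisson ρ α hα,
    lintegral_dirac' _ (measurable_ofReal_exp_inner α), inner_neg_right,
    ← ENNReal.ofReal_mul (Real.exp_pos _).le, ← Real.exp_add, sub_eq_add_neg]

end Compensated

/-! ### Distributions with small jumps -/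

section SmallJumps

variable {d : ℕ} {p : Measure (EuclideanSpace ℝ (Fin d))}

lemma integrable_cexp_sub_of_sq (hp : Integrable (fun x => ‖x‖ ^ 2) p)
    (z : EuclideanSpace ℝ (Fin d)) :
    Integrable (fun x => Complex.exp ((⟪z, x⟫ : ℝ) * Complex.I) - 1 -
      (⟪z, x⟫ : ℝ) * Complex.I) p := by
  refine (hp.const_mul (3 * ‖z‖ ^ 2)).mono' (by fun_prop) (.of_forall fun x => ?_)
  refine (norm_cexp_sub_one_sub_le_sq _).1.trans ?_
  have := abs_real_inner_le_norm z x
  rw [mul_assoc, ← mul_pow, ← sq_abs]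
  gcongr

lemma exp_sub_bound (α x : EuclideanSpace ℝ (Fin d)) (hx : ‖x‖ ≤ 1) :
    ‖Real.exp ⟪α, x⟫ - 1 - ⟪α, x⟫‖ ≤ ‖α‖ ^ 2 * Real.exp ‖α‖ * ‖x‖ ^ 2 := by
  have h1 := abs_real_inner_le_norm α x
  have h2 : |⟪α, x⟫| ≤ ‖α‖ := h1.trans (mul_le_of_le_one_right (norm_nonneg _) hx)
  calc ‖Real.exp ⟪α, x⟫ - 1 - ⟪α, x⟫‖ ≤ ⟪α, x⟫ ^ 2 * Real.exp |⟪α, x⟫| :=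
        abs_exp_sub_one_sub_le _
    _ ≤ (‖α‖ * ‖x‖) ^ 2 * Real.exp ‖α‖ := by rw [← sq_abs]; gcongr
    _ = _ := by ring

lemma integrable_exp_sub_of_sq (hp : Integrable (fun x => ‖x‖ ^ 2) p)
    (hb : ∀ᵐ x ∂p, ‖x‖ ≤ 1) (α : EuclideanSpace ℝ (Fin d)) :
    Integrable (fun x => Real.exp ⟪α, x⟫ - 1 - ⟪α, x⟫) p :=
  (hp.const_mul (‖α‖ ^ 2 * Real.exp ‖α‖)).mono' (by fun_prop)
    (hb.mono fun x hx => exp_sub_bound α x hx)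

/-- The sets increase to the complement of the origin, where `g` vanishes. -/
lemma tendsto_setIntegral_norm_gt {F : Type*} [NormedAddCommGroup F] [NormedSpace ℝ F]
    {g : EuclideanSpace ℝ (Fin d) → F} (hg : Integrable g p) (g0 : g 0 = 0) :
    Filter.Tendsto (fun n : ℕ => ∫ x in {x | 1 / ((n : ℝ) + 1) < ‖x‖}, g x ∂p) Filter.atTop
      (𝓝 (∫ x, g x ∂p)) := by
  have h := tendsto_setIntegral_of_monotone (μ := p) (f := g)
    (s := fun n : ℕ => {x : EuclideanSpace ℝ (Fin d) | 1 / ((n : ℝ) + 1) < ‖x‖})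
    (fun n => measurableSet_lt measurable_const measurable_norm)
    (fun m n hmn x hx => Set.mem_ofPred_eq ▸ (Nat.one_div_le_one_div hmn).trans_lt hx) hg.integrableOn
  rwa [setIntegral_eq_integral_of_forall_compl_eq_zero] at h
  intro x hx
  have : x = 0 := by
    by_contra hx0
    obtain ⟨n, hn⟩ := exists_nat_one_div_lt (norm_pos_iff.2 hx0)
    exact hx (Set.mem_iUnion.2 ⟨n, hn⟩)
  rw [this, g0]

lemma isFiniteMeasure_restrict_norm_gt (hp : Integrable (fun x => ‖x‖ ^ 2) p) {ε : ℝ}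
    (hε : 0 < ε) : IsFiniteMeasure (p.restrict {x | ε < ‖x‖}) := by
  constructor
  rw [Measure.restrict_apply_univ]
  refine (measure_mono ?_).trans_lt (hp.measure_norm_ge_lt_top (ε := ε ^ 2) (by positivity))
  intro x (hx : ε < ‖x‖)
  change ε ^ 2 ≤ ‖‖x‖ ^ 2‖
  rw [Real.norm_of_nonneg (by positivity)]
  gcongr

/-- For a measure on the unit ball which integrates `‖x‖²`, there is a distribution whose
characteristic exponent is the compensated one; its exponential moments are bounded by the
expected expression. -/
lemma exists_compensated_le (hp : Integrable (fun x => ‖x‖ ^ 2) p) (hb : ∀ᵐ x ∂p, ‖x‖ ≤ 1) :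
    ∃ S : Measure (EuclideanSpace ℝ (Fin d)), IsProbabilityMeasure S ∧
      (∀ z, charFun S z = Complex.exp (∫ x, (Complex.exp ((⟪z, x⟫ : ℝ) * Complex.I) - 1 -
        (⟪z, x⟫ : ℝ) * Complex.I) ∂p)) ∧
      ∀ α, ∫⁻ x, ENNReal.ofReal (Real.exp ⟪α, x⟫) ∂S ≤
        ENNReal.ofReal (Real.exp (∫ x, (Real.exp ⟪α, x⟫ - 1 - ⟪α, x⟫) ∂p)) := by
  -- Removing the jumps of size at most `1 / (n + 1)` leaves a finite measure on the unit ball, for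
  -- which the compensated compound Poisson law and both its transforms are explicit.
  set q : ℕ → Measure (EuclideanSpace ℝ (Fin d)) :=
    fun n => p.restrict {x | 1 / ((n : ℝ) + 1) < ‖x‖}
  have hq : ∀ n, IsFiniteMeasure (q n) :=
    fun n => isFiniteMeasure_restrict_norm_gt hp Nat.one_div_pos_of_nat
  have hqb : ∀ n, ∀ᵐ x ∂(q n), ‖x‖ ≤ 1 := fun n => ae_restrict_of_ae hb
  have hid : ∀ n, Integrable (fun x => x) (q n) := fun n =>
    (integrable_const (1 : ℝ)).mono' (by fun_prop) (hqb n)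
  have hexp : ∀ n (α : EuclideanSpace ℝ (Fin d)),
      Integrable (fun x => Real.exp ⟪α, x⟫) (q n) := fun n α =>
    (integrable_const (Real.exp ‖α‖)).mono' (by fun_prop) ((hqb n).mono fun x hx => by
      rw [Real.norm_of_nonneg (Real.exp_pos _).le, Real.exp_le_exp]
      exact (real_inner_le_norm α x).trans (mul_le_of_le_one_right (norm_nonneg _) hx))
  -- The limiting exponent is bounded by `3 * ‖z‖ ^ 2 * ∫ ‖x‖ ^ 2`, hence continuous at `0`.
  have hf : ContinuousAt (fun z => Complex.exp (∫ x, (Complex.exp ((⟪z, x⟫ : ℝ) * Complex.I) - 1 -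
        (⟪z, x⟫ : ℝ) * Complex.I) ∂p)) 0 := by
    refine ContinuousAt.cexp ?_
    rw [ContinuousAt]
    simp only [inner_zero_left, Complex.ofReal_zero, zero_mul, Complex.exp_zero, sub_self,
      integral_zero]
    rw [tendsto_zero_iff_norm_tendsto_zero]
    have hlim : Filter.Tendsto (fun z : EuclideanSpace ℝ (Fin d) =>
        ∫ x, 3 * ‖z‖ ^ 2 * ‖x‖ ^ 2 ∂p) (𝓝 0) (𝓝 0) := by
      simp_rw [integral_const_mul]
      have : ContinuousAt (fun z : EuclideanSpace ℝ (Fin d) =>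
        3 * ‖z‖ ^ 2 * ∫ x, ‖x‖ ^ 2 ∂p) 0 := by fun_prop
      simpa [ContinuousAt] using this
    refine squeeze_zero (fun _ => norm_nonneg _) (fun z => ?_) hlim
    refine norm_integral_le_of_norm_le (hp.const_mul _) (.of_forall fun x => ?_)
    refine (norm_cexp_sub_one_sub_le_sq _).1.trans ?_
    have := abs_real_inner_le_norm z x
    rw [mul_assoc, ← mul_pow, ← sq_abs]
    gcongr
  obtain ⟨S, hS, hlim⟩ := exists_tendsto_of_tendsto_charFun
    (fun n => ⟨compensatedPoisson (q n), inferInstance⟩) hf (fun z => by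
      simp only [ProbabilityMeasure.coe_mk, charFun_compensatedPoisson _ (hid _)]
      exact (tendsto_setIntegral_norm_gt (integrable_cexp_sub_of_sq hp z) (by simp)).cexp)
  refine ⟨S, inferInstance, hS, fun α => lintegral_le_of_tendsto hlim (by fun_prop)
    (fun x => (Real.exp_pos _).le) ?_⟩
  simp only [ProbabilityMeasure.coe_mk,
    lintegral_exp_inner_compensatedPoisson _ (hid _) α (hexp _ α)]
  exact ENNReal.tendsto_ofReal
    ((tendsto_setIntegral_norm_gt (integrable_exp_sub_of_sq hp hb α) (by simp)).rexp)

/-- Cauchy–Schwarz for `exp (⟪α, x⟫ / 2)` and its reciprocal. It converts an upper bound for the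
Laplace transform at `-α` into a lower bound at `α`. -/
lemma one_le_lintegral_exp_mul_neg (S : Measure (EuclideanSpace ℝ (Fin d)))
    [IsProbabilityMeasure S] (α : EuclideanSpace ℝ (Fin d)) :
    1 ≤ (∫⁻ x, ENNReal.ofReal (Real.exp ⟪α, x⟫) ∂S) *
      ∫⁻ x, ENNReal.ofReal (Real.exp ⟪-α, x⟫) ∂S := by
  have h := ENNReal.lintegral_mul_le_Lp_mul_Lq S (p := 2) (q := 2) (by
      rw [Real.holderConjugate_iff]; norm_num)
    (f := fun x => ENNReal.ofReal (Real.exp (⟪α, x⟫ / 2)))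
    (g := fun x => ENNReal.ofReal (Real.exp (-⟪α, x⟫ / 2))) (by fun_prop) (by fun_prop)
  have e1 : ∀ x, ENNReal.ofReal (Real.exp (⟪α, x⟫ / 2)) ^ (2 : ℝ) =
      ENNReal.ofReal (Real.exp ⟪α, x⟫) := fun x => by
    rw [ENNReal.ofReal_rpow_of_nonneg (Real.exp_pos _).le (by norm_num), ← Real.exp_mul]
    ring_nf
  have e2 : ∀ x, ENNReal.ofReal (Real.exp (-⟪α, x⟫ / 2)) ^ (2 : ℝ) =
      ENNReal.ofReal (Real.exp ⟪-α, x⟫) := fun x => by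
    rw [ENNReal.ofReal_rpow_of_nonneg (Real.exp_pos _).le (by norm_num), ← Real.exp_mul,
      inner_neg_left]
    ring_nf
  have e3 : ∀ x, ENNReal.ofReal (Real.exp (⟪α, x⟫ / 2)) *
      ENNReal.ofReal (Real.exp (-⟪α, x⟫ / 2)) = 1 := fun x => by
    rw [← ENNReal.ofReal_mul (Real.exp_pos _).le, ← Real.exp_add]
    ring_nf
    simp
  simp only [Pi.mul_apply, e1, e2, e3, lintegral_const, measure_univ, mul_one] at h
  rw [← ENNReal.mul_rpow_of_nonneg _ _ (by norm_num)] at h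
  by_contra! hlt
  exact absurd h (not_le.2 (ENNReal.rpow_lt_one hlt (by norm_num)))

/-- For a measure on the unit ball which integrates `‖x‖²`, there is a distribution whose
characteristic exponent and logarithmic Laplace transform are the compensated ones. -/
theorem exists_compensated (hp : Integrable (fun x => ‖x‖ ^ 2) p) (hb : ∀ᵐ x ∂p, ‖x‖ ≤ 1) :
    ∃ S : Measure (EuclideanSpace ℝ (Fin d)), IsProbabilityMeasure S ∧
      (∀ z, charFun S z = Complex.exp (∫ x, (Complex.exp ((⟪z, x⟫ : ℝ) * Complex.I) - 1 -
        (⟪z, x⟫ : ℝ) * Complex.I) ∂p)) ∧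
      ∀ α, ∫⁻ x, ENNReal.ofReal (Real.exp ⟪α, x⟫) ∂S =
        ENNReal.ofReal (Real.exp (∫ x, (Real.exp ⟪α, x⟫ - 1 - ⟪α, x⟫) ∂p)) := by
  obtain ⟨S, hS, hSc, hSe⟩ := exists_compensated_le hp hb
  -- Only `≥` is left. For each `n` the law `S` splits into the jumps larger than `1 / (n + 1)`,
  -- with exact transform, and a remainder `T`, whose transform at `α` is at least `exp (-K (-α)
  -- sᶜ)`. These lower bounds converge to the claimed value.
  refine ⟨S, hS, hSc, fun α => le_antisymm (hSe α) ?_⟩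
  have hi := integrable_exp_sub_of_sq hp hb
  have hic := integrable_cexp_sub_of_sq hp
  set K : EuclideanSpace ℝ (Fin d) → Set (EuclideanSpace ℝ (Fin d)) → ℝ :=
    fun β s => ∫ x in s, (Real.exp ⟪β, x⟫ - 1 - ⟪β, x⟫) ∂p
  have hmeas : ∀ n : ℕ, MeasurableSet {x : EuclideanSpace ℝ (Fin d) | 1 / ((n : ℝ) + 1) < ‖x‖} :=
    fun n => measurableSet_lt measurable_const measurable_norm
  have hsplit : ∀ β (n : ℕ), K β {x | 1 / ((n : ℝ) + 1) < ‖x‖}ᶜ =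
      (∫ x, (Real.exp ⟪β, x⟫ - 1 - ⟪β, x⟫) ∂p) - K β {x | 1 / ((n : ℝ) + 1) < ‖x‖} :=
    fun β n => eq_sub_of_add_eq' (integral_add_compl (hmeas n) (hi β))
  have hlimK := fun β => tendsto_setIntegral_norm_gt (hi β) (by simp)
  have hlim0 : Filter.Tendsto (fun n : ℕ => K (-α) {x | 1 / ((n : ℝ) + 1) < ‖x‖}ᶜ)
      Filter.atTop (𝓝 0) := by
    simp_rw [hsplit]
    have := (tendsto_const_nhds (x := ∫ x, (Real.exp ⟪-α, x⟫ - 1 - ⟪-α, x⟫) ∂p)).sub (hlimK (-α))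
    rwa [sub_self] at this
  have hlim : Filter.Tendsto (fun n : ℕ => ENNReal.ofReal (Real.exp
      (K α {x | 1 / ((n : ℝ) + 1) < ‖x‖} - K (-α) {x | 1 / ((n : ℝ) + 1) < ‖x‖}ᶜ)))
      Filter.atTop
      (𝓝 (ENNReal.ofReal (Real.exp (∫ x, (Real.exp ⟪α, x⟫ - 1 - ⟪α, x⟫) ∂p)))) := by
    refine ENNReal.tendsto_ofReal (Filter.Tendsto.rexp ?_)
    simpa using (hlimK α).sub hlim0
  refine le_of_tendsto' hlim fun n => ?_
  set s := {x : EuclideanSpace ℝ (Fin d) | 1 / ((n : ℝ) + 1) < ‖x‖} with hs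
  have : IsFiniteMeasure (p.restrict s) :=
    isFiniteMeasure_restrict_norm_gt hp Nat.one_div_pos_of_nat
  have hsb : ∀ᵐ x ∂(p.restrict s), ‖x‖ ≤ 1 := ae_restrict_of_ae hb
  have hid : Integrable (fun x => x) (p.restrict s) :=
    (integrable_const (1 : ℝ)).mono' (by fun_prop) hsb
  have hexp : Integrable (fun x => Real.exp ⟪α, x⟫) (p.restrict s) :=
    (integrable_const (Real.exp ‖α‖)).mono' (by fun_prop) (hsb.mono fun x hx => by
      rw [Real.norm_of_nonneg (Real.exp_pos _).le, Real.exp_le_exp]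
      exact (real_inner_le_norm α x).trans (mul_le_of_le_one_right (norm_nonneg _) hx))
  obtain ⟨T, hT, hTc, hTe⟩ := exists_compensated_le (p := p.restrict sᶜ) hp.integrableOn
    (ae_restrict_of_ae hb)
  have hconv : S = compensatedPoisson (p.restrict s) ∗ T := by
    refine Measure.ext_of_charFun (funext fun z => ?_)
    rw [charFun_conv, hSc, charFun_compensatedPoisson _ hid, hTc, ← Complex.exp_add,
      integral_add_compl (hmeas n) (hic z)]
  have hT1 := one_le_lintegral_exp_mul_neg T α
  rw [mul_comm] at hT1
  -- The upper bound for `T` at `-α`, inverted by means of `hT1`.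
  have hTlow : ENNReal.ofReal (Real.exp (-K (-α) sᶜ)) ≤
      ∫⁻ x, ENNReal.ofReal (Real.exp ⟪α, x⟫) ∂T := by
    rw [Real.exp_neg, ENNReal.ofReal_inv_of_pos (Real.exp_pos _)]
    refine (ENNReal.inv_le_inv.2 (hTe (-α))).trans ?_
    refine (ENNReal.inv_le_iff_le_mul (fun _ h0 => ?_) (fun _ h0 => ?_)).2 hT1
    all_goals
      rw [h0] at hT1
      simp at hT1
  rw [sub_eq_add_neg, Real.exp_add, ENNReal.ofReal_mul (Real.exp_pos _).le, hconv,
    lintegral_exp_inner_conv, lintegral_exp_inner_compensatedPoisson _ hid α hexp]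
  gcongr

end SmallJumps

end

/-! ### Deconvolution of `μ`; submultiplicative and exponential moments. -/

noncomputable section

/-! ### Integrals with respect to Lévy measures -/

section LevyMeasure

variable {d : ℕ} {p : Measure (EuclideanSpace ℝ (Fin d))}

lemma measurableSet_norm_gt_one : MeasurableSet {x : EuclideanSpace ℝ (Fin d) | 1 < ‖x‖} :=
  measurableSet_lt measurable_const measurable_norm

lemma ae_restrict_norm_le_one :
    ∀ᵐ x ∂(p.restrict {x : EuclideanSpace ℝ (Fin d) | 1 < ‖x‖}ᶜ), ‖x‖ ≤ 1 :=
  (ae_restrict_mem measurableSet_norm_gt_one.compl).mono fun _ hx => not_lt.1 hx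

lemma unitBallInd_of_le {x : EuclideanSpace ℝ (Fin d)} (hx : ‖x‖ ≤ 1) : unitBallInd x = 1 :=
  Set.indicator_of_mem (by simpa using hx) _

lemma unitBallInd_of_gt {x : EuclideanSpace ℝ (Fin d)} (hx : 1 < ‖x‖) : unitBallInd x = 0 :=
  Set.indicator_of_notMem (by simpa using hx) _

lemma isFiniteMeasure_restrict_norm_gt_one (hp : Integrable (fun x => min 1 (‖x‖ ^ 2)) p) :
    IsFiniteMeasure (p.restrict {x | 1 < ‖x‖}) := by
  constructor
  rw [Measure.restrict_apply_univ]
  refine (measure_mono ?_).trans_lt (hp.measure_norm_ge_lt_top one_pos)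
  intro x (hx : 1 < ‖x‖)
  change 1 ≤ ‖min 1 (‖x‖ ^ 2)‖
  rw [min_eq_left (one_le_pow₀ hx.le), norm_one]

lemma integrableOn_norm_sq (hp : Integrable (fun x => min 1 (‖x‖ ^ 2)) p) :
    Integrable (fun x => ‖x‖ ^ 2) (p.restrict {x | 1 < ‖x‖}ᶜ) := by
  refine (hp.restrict (s := {x | 1 < ‖x‖}ᶜ)).congr (ae_restrict_norm_le_one.mono fun x hx => ?_)
  exact min_eq_right (pow_le_one₀ (norm_nonneg x) hx)

lemma integrable_iff_restrict {F : Type*} [NormedAddCommGroup F]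
    (f : EuclideanSpace ℝ (Fin d) → F) :
    Integrable f p ↔ Integrable f (p.restrict {x | 1 < ‖x‖}ᶜ) ∧
      Integrable f (p.restrict {x | 1 < ‖x‖}) := by
  rw [← integrableOn_univ, ← Set.compl_union_self {x : EuclideanSpace ℝ (Fin d) | 1 < ‖x‖}]
  exact integrableOn_union

lemma integral_eq_add_restrict {F : Type*} [NormedAddCommGroup F] [NormedSpace ℝ F]
    {f : EuclideanSpace ℝ (Fin d) → F} (hf : Integrable f p) :
    ∫ x, f x ∂p = (∫ x in {x | 1 < ‖x‖}ᶜ, f x ∂p) + ∫ x in {x | 1 < ‖x‖}, f x ∂p := by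
  rw [add_comm]
  exact (integral_add_compl measurableSet_norm_gt_one hf).symm

lemma ae_restrict_small_eq {F : Type*} {f g : EuclideanSpace ℝ (Fin d) → F}
    (h : ∀ x, ‖x‖ ≤ 1 → f x = g x) : f =ᵐ[p.restrict {x | 1 < ‖x‖}ᶜ] g :=
  ae_restrict_norm_le_one.mono h

lemma ae_restrict_big_eq {F : Type*} {f g : EuclideanSpace ℝ (Fin d) → F}
    (h : ∀ x, 1 < ‖x‖ → f x = g x) : f =ᵐ[p.restrict {x | 1 < ‖x‖}] g :=
  (ae_restrict_mem measurableSet_norm_gt_one).mono h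

/-- Near the origin the integrand is `O(|x|²)`; on `{|x| > 1}` the truncation leaves a bounded
function and `p` is finite there. -/
lemma integrable_levyIntegrand (hp : Integrable (fun x => min 1 (‖x‖ ^ 2)) p)
    (z : EuclideanSpace ℝ (Fin d)) :
    Integrable (fun x => Complex.exp ((⟪z, x⟫ : ℝ) * Complex.I) - 1 -
      (⟪z, x⟫ * unitBallInd x : ℝ) * Complex.I) p := by
  have := isFiniteMeasure_restrict_norm_gt_one hp
  rw [integrable_iff_restrict]
  constructor
  · refine (integrable_cexp_sub_of_sq (integrableOn_norm_sq hp) z).congr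
      (ae_restrict_small_eq fun x hx => ?_)
    rw [unitBallInd_of_le hx, mul_one]
  · refine ((integrable_cexp_inner_mul_I _ z).sub (integrable_const 1)).congr
      (ae_restrict_big_eq fun x hx => ?_)
    simp [unitBallInd_of_gt hx]

lemma finiteMomentOn_iff_integrable {h : EuclideanSpace ℝ (Fin d) → ℝ} (h0 : ∀ x, 0 ≤ h x)
    (hm : Measurable h) (s : Set (EuclideanSpace ℝ (Fin d))) :
    FiniteMomentOn h s p ↔ Integrable h (p.restrict s) := by
  rw [FiniteMomentOn, ← hasFiniteIntegral_iff_ofReal (.of_forall h0)]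
  exact ⟨fun h => ⟨hm.aestronglyMeasurable, h⟩, fun h => h.2⟩

lemma finiteMomentOn_exp_iff (α : EuclideanSpace ℝ (Fin d))
    (s : Set (EuclideanSpace ℝ (Fin d))) :
    FiniteMomentOn (fun x => Real.exp ⟪α, x⟫) s p ↔
      Integrable (fun x => Real.exp ⟪α, x⟫) (p.restrict s) :=
  finiteMomentOn_iff_integrable (fun _ => (Real.exp_pos _).le) (by fun_prop) s

lemma integrable_exp_levyIntegrand (hp : Integrable (fun x => min 1 (‖x‖ ^ 2)) p)
    {α : EuclideanSpace ℝ (Fin d)}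
    (hα : FiniteMomentOn (fun x => Real.exp ⟪α, x⟫) {x | 1 < ‖x‖} p) :
    Integrable (fun x => Real.exp ⟪α, x⟫ - 1 - ⟪α, x⟫ * unitBallInd x) p := by
  have := isFiniteMeasure_restrict_norm_gt_one hp
  rw [finiteMomentOn_exp_iff] at hα
  rw [integrable_iff_restrict]
  constructor
  · refine (integrable_exp_sub_of_sq (integrableOn_norm_sq hp) ae_restrict_norm_le_one α).congr
      (ae_restrict_small_eq fun x hx => ?_)
    rw [unitBallInd_of_le hx, mul_one]
  · refine (hα.sub (integrable_const 1)).congr (ae_restrict_big_eq fun x hx => ?_)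
    simp [unitBallInd_of_gt hx]

end LevyMeasure

/-! ### Infinitely divisible distributions without Gaussian part -/

section LevyLaw

variable {d : ℕ}

/-- `L` is a probability measure with characteristic triplet `(0, p, 0)`, whose submultiplicative
moments are governed by those of `p` over `{x : |x| > 1}`. -/
structure IsLevyLaw (p L : Measure (EuclideanSpace ℝ (Fin d))) : Prop where
  isProbabilityMeasure : IsProbabilityMeasure L
  charFun_eq : ∀ z, charFun L z = Complex.exp (∫ x, (Complex.exp ((⟪z, x⟫ : ℝ) * Complex.I) - 1 -
    (⟪z, x⟫ * unitBallInd x : ℝ) * Complex.I) ∂p)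
  lintegral_lt_top_iff : ∀ h : EuclideanSpace ℝ (Fin d) → ℝ,
    IsSubmultiplicative h → IsLocallyBounded h → Measurable h →
      (∫⁻ x, ENNReal.ofReal (h x) ∂L < ∞ ↔ FiniteMomentOn h {x | 1 < ‖x‖} p)
  lintegral_exp : ∀ α, FiniteMomentOn (fun x => Real.exp ⟪α, x⟫) {x | 1 < ‖x‖} p →
    ∫⁻ x, ENNReal.ofReal (Real.exp ⟪α, x⟫) ∂L =
      ENNReal.ofReal (Real.exp (∫ x, (Real.exp ⟪α, x⟫ - 1 - ⟪α, x⟫ * unitBallInd x) ∂p))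

/-- Small and large jumps are convolved. The small-jump factor `S` has every exponential moment,
hence every moment in question, so finiteness is decided by the compound Poisson factor alone. -/
theorem exists_isLevyLaw {p : Measure (EuclideanSpace ℝ (Fin d))}
    (hp : Integrable (fun x => min 1 (‖x‖ ^ 2)) p) : ∃ L, IsLevyLaw p L := by
  have := isFiniteMeasure_restrict_norm_gt_one hp
  obtain ⟨S, hS, hSc, hSe⟩ :=
    exists_compensated (integrableOn_norm_sq hp) ae_restrict_norm_le_one
  refine ⟨S ∗ compoundPoisson (p.restrict {x | 1 < ‖x‖}), inferInstance, fun z => ?_,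
    fun h hs hb hm => ?_, fun α hα => ?_⟩
  · rw [charFun_conv, hSc, charFun_compoundPoisson, ← Complex.exp_add,
      integral_eq_add_restrict (integrable_levyIntegrand hp z)]
    congr 2
    · refine integral_congr_ae (ae_restrict_small_eq fun x hx => ?_)
      rw [unitBallInd_of_le hx, mul_one]
    · refine integral_congr_ae (ae_restrict_big_eq fun x hx => ?_)
      simp [unitBallInd_of_gt hx]
  · rw [lintegral_conv_lt_top_iff hs hm, lintegral_compoundPoisson_lt_top_iff _ hs hm]
    exact and_iff_right (hs.lintegral_lt_top hb S fun α => hSe α ▸ ENNReal.ofReal_lt_top)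
  · have hα' := (finiteMomentOn_exp_iff α _).1 hα
    rw [lintegral_exp_inner_conv, hSe, lintegral_exp_inner_compoundPoisson _ _ hα',
      ← ENNReal.ofReal_mul (Real.exp_pos _).le, ← Real.exp_add,
      integral_eq_add_restrict (integrable_exp_levyIntegrand hp hα)]
    congr 3
    · refine integral_congr_ae (ae_restrict_small_eq fun x hx => ?_)
      simp only [unitBallInd_of_le hx, mul_one]
    · refine integral_congr_ae (ae_restrict_big_eq fun x hx => ?_)
      simp only [unitBallInd_of_gt hx, mul_zero, sub_zero]

end LevyLaw

/-! ### Gaussian distributions -/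

section Gaussian

variable {d : ℕ}

lemma quadForm_eq_dotProduct (A : Matrix (Fin d) (Fin d) ℝ) (z : EuclideanSpace ℝ (Fin d)) :
    quadForm A z = z ⬝ᵥ A *ᵥ z := by
  rw [quadForm, EuclideanSpace.inner_eq_star_dotProduct, dotProduct_comm]
  simp

lemma charFun_multivariateGaussian_quadForm (m : EuclideanSpace ℝ (Fin d))
    {A : Matrix (Fin d) (Fin d) ℝ} (hA : A.PosSemidef) (z : EuclideanSpace ℝ (Fin d)) :
    charFun (multivariateGaussian m A) z =
      Complex.exp ((⟪m, z⟫ : ℝ) * Complex.I - (quadForm A z : ℝ) / 2) := by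
  rw [charFun_multivariateGaussian hA, quadForm_eq_dotProduct, real_inner_comm]

/-- The image under `⟪α, ·⟫` is a real Gaussian with variance `quadForm A α`; its moment generating
function is evaluated at `1`. -/
lemma lintegral_exp_multivariateGaussian (m : EuclideanSpace ℝ (Fin d))
    {A : Matrix (Fin d) (Fin d) ℝ} (hA : A.PosSemidef) (α : EuclideanSpace ℝ (Fin d)) :
    ∫⁻ x, ENNReal.ofReal (Real.exp ⟪α, x⟫) ∂(multivariateGaussian m A) =
      ENNReal.ofReal (Real.exp (⟪α, m⟫ + quadForm A α / 2)) := by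
  have h0 : 0 ≤ quadForm A α := by
    rw [quadForm_eq_dotProduct]
    simpa using hA.dotProduct_mulVec_nonneg α
  have hmap : (multivariateGaussian m A).map (innerSL ℝ α) =
      gaussianReal ⟪α, m⟫ (quadForm A α).toNNReal := by
    rw [IsGaussian.map_eq_gaussianReal, ContinuousLinearMap.integral_comp_id_comm
      IsGaussian.integrable_id, integral_id_multivariateGaussian]
    congr 2
    rw [quadForm_eq_dotProduct, ← covarianceBilin_multivariateGaussian (μ := m) hA,
      covarianceBilin_self IsGaussian.memLp_two_id]
    rfl
  have e : ∫⁻ x, ENNReal.ofReal (Real.exp ⟪α, x⟫) ∂(multivariateGaussian m A) =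
      ∫⁻ y, ENNReal.ofReal (Real.exp y) ∂((multivariateGaussian m A).map (innerSL ℝ α)) := by
    rw [lintegral_map (by fun_prop) (by fun_prop)]
    rfl
  have hi := integrable_exp_mul_gaussianReal (μ := ⟪α, m⟫) (v := (quadForm A α).toNNReal) 1
  have hm := congrFun (mgf_fun_id_gaussianReal (μ := ⟪α, m⟫) (v := (quadForm A α).toNNReal)) 1
  simp only [one_mul, mgf, mul_one, one_pow, Real.coe_toNNReal _ h0] at hi hm
  rw [e, hmap, ← hm, ofReal_integral_eq_lintegral_ofReal hi (.of_forall fun _ =>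
    (Real.exp_pos _).le)]

/-- The Gaussian laws need positive semidefinite matrices, whereas `A` is only known to be
symmetric. The operator norm of `A` serves as `c`. -/
lemma exists_posSemidef_add_smul_one {A : Matrix (Fin d) (Fin d) ℝ} (hA : A.IsSymm) :
    ∃ c : ℝ, (A + c • (1 : Matrix (Fin d) (Fin d) ℝ)).PosSemidef ∧
      (c • (1 : Matrix (Fin d) (Fin d) ℝ)).PosSemidef := by
  set T := (Matrix.toEuclideanLin A).toContinuousLinearMap
  refine ⟨‖T‖, Matrix.PosSemidef.of_dotProduct_mulVec_nonneg ?_ fun x => ?_,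
    Matrix.PosSemidef.one.smul (norm_nonneg T)⟩
  · refine Matrix.IsHermitian.add ?_ ?_
    · rw [Matrix.IsHermitian, Matrix.conjTranspose_eq_transpose_of_trivial]
      exact hA
    · exact (Matrix.PosSemidef.one.smul (norm_nonneg T)).1
  · set z : EuclideanSpace ℝ (Fin d) := WithLp.toLp 2 x
    have h1 : x ⬝ᵥ A *ᵥ x = ⟪z, T z⟫ := (quadForm_eq_dotProduct A z).symm
    have h2 : x ⬝ᵥ x = ‖z‖ ^ 2 := by
      rw [← real_inner_self_eq_norm_sq, EuclideanSpace.inner_eq_star_dotProduct]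
      simp [z]
    have h3 := abs_real_inner_le_norm z (T z)
    have h4 := T.le_opNorm z
    have h5 : ‖z‖ * ‖T z‖ ≤ ‖T‖ * ‖z‖ ^ 2 := by nlinarith [norm_nonneg z]
    rw [star_trivial, Matrix.add_mulVec, Matrix.smul_mulVec, Matrix.one_mulVec, dotProduct_add,
      dotProduct_smul, h1, h2, smul_eq_mul]
    linarith [neg_abs_le ⟪z, T z⟫]

lemma quadForm_add (A B : Matrix (Fin d) (Fin d) ℝ) (z : EuclideanSpace ℝ (Fin d)) :
    quadForm (A + B) z = quadForm A z + quadForm B z := by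
  simp [quadForm_eq_dotProduct, Matrix.add_mulVec, dotProduct_add]

end Gaussian

/-! ### Quasi-infinitely divisible distributions as deconvolutions -/

section Factorization

variable {d : ℕ} {μ : Measure (EuclideanSpace ℝ (Fin d))} {A : Matrix (Fin d) (Fin d) ℝ}
  {ν : PunctualSignedMeasure d} {γ : EuclideanSpace ℝ (Fin d)}

lemma PunctualSignedMeasure.IsQuasiLevyType.integrable_posPart (hν : ν.IsQuasiLevyType) :
    Integrable (fun x => min 1 (‖x‖ ^ 2)) ν.posPart :=
  integrableOn_univ.1 hν.1

lemma PunctualSignedMeasure.IsQuasiLevyType.integrable_negPart (hν : ν.IsQuasiLevyType) :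
    Integrable (fun x => min 1 (‖x‖ ^ 2)) ν.negPart :=
  integrableOn_univ.1 hν.2

/-- A quasi-infinitely divisible distribution, convolved with a distribution with Lévy measure
`ν⁻`, is a distribution with Lévy measure `ν⁺`. -/
theorem HasStandardTriplet.exists_conv_eq (hμ : HasStandardTriplet μ A ν γ) :
    ∃ (B : Matrix (Fin d) (Fin d) ℝ) (L₁ L₂ : Measure (EuclideanSpace ℝ (Fin d))),
      (A + B).PosSemidef ∧ B.PosSemidef ∧ IsLevyLaw ν.posPart L₁ ∧ IsLevyLaw ν.negPart L₂ ∧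
      μ ∗ (multivariateGaussian 0 B ∗ L₂) = multivariateGaussian γ (A + B) ∗ L₁ := by
  obtain ⟨c, hAc, hc⟩ := exists_posSemidef_add_smul_one hμ.symm
  obtain ⟨L₁, hL₁⟩ := exists_isLevyLaw hμ.quasiLevy.integrable_posPart
  obtain ⟨L₂, hL₂⟩ := exists_isLevyLaw hμ.quasiLevy.integrable_negPart
  refine ⟨c • 1, L₁, L₂, hAc, hc, hL₁, hL₂, ?_⟩
  have := hμ.qid.1
  have := hL₁.isProbabilityMeasure
  have := hL₂.isProbabilityMeasure
  refine Measure.ext_of_charFun (funext fun z => ?_)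
  rw [charFun_conv, charFun_conv, charFun_conv, hμ.charFun_eq, hL₁.charFun_eq, hL₂.charFun_eq,
    charFun_multivariateGaussian_quadForm _ hc, charFun_multivariateGaussian_quadForm _ hAc,
    quadForm_add, ← Complex.exp_add, ← Complex.exp_add, ← Complex.exp_add,
    PunctualSignedMeasure.integralOn, Measure.restrict_univ, Measure.restrict_univ]
  congr 1
  simp only [inner_zero_left]
  push_cast
  ring

end Factorization

/-! ### Submultiplicative and exponential moments -/

section Moments

variable {d : ℕ} {μ : Measure (EuclideanSpace ℝ (Fin d))} {A : Matrix (Fin d) (Fin d) ℝ}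
  {ν : PunctualSignedMeasure d} {γ : EuclideanSpace ℝ (Fin d)}

/-- In `hconv` the moment is finite on each side exactly when it is finite for all factors there.
The Gaussian factors drop out, and `L₁`, `L₂` translate into `ν⁺`, `ν⁻`. -/
theorem HasStandardTriplet.finiteMoment_iff (hμ : HasStandardTriplet μ A ν γ)
    {h : EuclideanSpace ℝ (Fin d) → ℝ} (hs : IsSubmultiplicative h) (hb : IsLocallyBounded h)
    (hm : Measurable h) :
    FiniteMomentOn h {x | 1 < ‖x‖} ν.posPart ↔
      FiniteMomentOn h Set.univ μ ∧ FiniteMomentOn h {x | 1 < ‖x‖} ν.negPart := by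
  obtain ⟨B, L₁, L₂, hAB, hB, hL₁, hL₂, hconv⟩ := hμ.exists_conv_eq
  have := hμ.qid.1
  have := hL₁.isProbabilityMeasure
  have := hL₂.isProbabilityMeasure
  have hG : ∀ (m : EuclideanSpace ℝ (Fin d)) {D : Matrix (Fin d) (Fin d) ℝ}, D.PosSemidef →
      ∫⁻ x, ENNReal.ofReal (h x) ∂(multivariateGaussian m D) < ∞ := fun m D hD =>
    hs.lintegral_lt_top hb _ fun α =>
      lintegral_exp_multivariateGaussian m hD α ▸ ENNReal.ofReal_lt_top
  have key := congrArg (fun P : Measure (EuclideanSpace ℝ (Fin d)) =>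
    ∫⁻ x, ENNReal.ofReal (h x) ∂P < ∞) hconv
  simp only [eq_iff_iff, lintegral_conv_lt_top_iff hs hm, hG _ hAB, hG _ hB, true_and,
    hL₁.lintegral_lt_top_iff h hs hb hm, hL₂.lintegral_lt_top_iff h hs hb hm] at key
  rw [← key, FiniteMomentOn.eq_def h Set.univ μ, Measure.restrict_univ]

lemma isSubmultiplicative_exp_inner (α : EuclideanSpace ℝ (Fin d)) :
    IsSubmultiplicative fun x => Real.exp ⟪α, x⟫ :=
  ⟨fun x => (Real.exp_pos _).le, 1, one_pos, fun x y => by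
    simp only [inner_add_right, Real.exp_add, one_mul, le_refl]⟩

lemma isLocallyBounded_of_continuous {h : EuclideanSpace ℝ (Fin d) → ℝ} (hc : Continuous h) :
    IsLocallyBounded h := fun x =>
  ⟨|h x| + 1, hc.abs.continuousAt.eventually_le_const (lt_add_one |h x|)⟩

/-- Exponential moments multiply along `hconv`. All factors except that of `μ` are known
exponentials, and the auxiliary matrix `B` cancels in the quotient. -/
theorem HasStandardTriplet.exp_moment (hμ : HasStandardTriplet μ A ν γ)
    {α : EuclideanSpace ℝ (Fin d)}
    (hα : FiniteMomentOn (fun x => Real.exp ⟪α, x⟫) {x | 1 < ‖x‖} ν.posPart) :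
    Integrable (fun x => Real.exp ⟪α, x⟫) μ ∧
    ν.IntegrableOn (fun x => Real.exp ⟪α, x⟫ - 1 - ⟪α, x⟫ * unitBallInd x) Set.univ ∧
    ∫ x, Real.exp ⟪α, x⟫ ∂μ = Real.exp (⟪α, γ⟫ + quadForm A α / 2 +
      ν.integralOn (fun x => Real.exp ⟪α, x⟫ - 1 - ⟪α, x⟫ * unitBallInd x) Set.univ) := by
  obtain ⟨hα', hα''⟩ := (hμ.finiteMoment_iff (isSubmultiplicative_exp_inner α)
    (isLocallyBounded_of_continuous (by fun_prop)) (by fun_prop)).1 hα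
  have hint : Integrable (fun x => Real.exp ⟪α, x⟫) μ := by
    simpa using (finiteMomentOn_exp_iff α _).1 hα'
  refine ⟨hint, ⟨(integrable_exp_levyIntegrand hμ.quasiLevy.integrable_posPart hα).integrableOn,
    (integrable_exp_levyIntegrand hμ.quasiLevy.integrable_negPart hα'').integrableOn⟩, ?_⟩
  obtain ⟨B, L₁, L₂, hAB, hB, hL₁, hL₂, hconv⟩ := hμ.exists_conv_eq
  have := hL₁.isProbabilityMeasure
  have := hL₂.isProbabilityMeasure
  have key := congrArg (fun P : Measure (EuclideanSpace ℝ (Fin d)) =>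
    ∫⁻ x, ENNReal.ofReal (Real.exp ⟪α, x⟫) ∂P) hconv
  have h0 : 0 ≤ ∫ x, Real.exp ⟪α, x⟫ ∂μ := integral_nonneg fun x => (Real.exp_pos _).le
  simp only [lintegral_exp_inner_conv, lintegral_exp_multivariateGaussian _ hAB,
    lintegral_exp_multivariateGaussian _ hB, hL₁.lintegral_exp α hα, hL₂.lintegral_exp α hα'',
    ← ofReal_integral_eq_lintegral_ofReal hint (.of_forall fun _ => (Real.exp_pos _).le),
    ← ENNReal.ofReal_mul (Real.exp_pos _).le, ← ENNReal.ofReal_mul h0, ← Real.exp_add] at key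
  rw [ENNReal.ofReal_eq_ofReal_iff (by positivity) (by positivity), ← eq_div_iff
    (Real.exp_pos _).ne', ← Real.exp_sub, quadForm_add, inner_zero_right] at key
  rw [key, PunctualSignedMeasure.integralOn, Measure.restrict_univ, Measure.restrict_univ]
  congr 1
  ring

end Moments

end

/-! ### Mean and second moments from the characteristic function near the origin. -/

noncomputable section

/-! ### Expansion of characteristic exponents at the origin -/

section Expansion

variable {Ω : Type*} [MeasurableSpace Ω] {ρ : Measure Ω} {Y : Ω → ℝ}

/-- Dominated convergence. The majorant uses a minimum because a Lévy measure with finite first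
moment at infinity need integrate neither `|Y|` (small jumps) nor `Y ^ 2` (large jumps). -/
lemma tendsto_integral_cexp_sub_div (hm : Measurable Y)
    (hY : Integrable (fun ω => min |Y ω| (Y ω ^ 2)) ρ) :
    Filter.Tendsto (fun t : ℝ => (∫ ω, (Complex.exp ((t * Y ω : ℝ) * Complex.I) - 1 -
      (t * Y ω : ℝ) * Complex.I) ∂ρ) / t) (𝓝[≠] 0) (𝓝 0) := by
  simp_rw [← integral_div]
  rw [← integral_zero Ω ℂ (μ := ρ)]
  refine tendsto_integral_filter_of_dominated_convergence
    (fun ω => 3 * min |Y ω| (Y ω ^ 2)) (.of_forall fun t => by fun_prop) ?_ (hY.const_mul 3)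
    (.of_forall fun ω => ?_)
  · have hle : ∀ᶠ t : ℝ in 𝓝[≠] 0, |t| ≤ 1 :=
      (continuous_abs.continuousAt.eventually_le_const (by simp)).filter_mono nhdsWithin_le_nhds
    filter_upwards [hle, self_mem_nhdsWithin] with t ht ht0
    refine .of_forall fun ω => ?_
    obtain ⟨h1, h2⟩ := norm_cexp_sub_one_sub_le_sq (t * Y ω)
    have ht' : 0 < |t| := abs_pos.2 ht0
    rw [norm_div, Complex.norm_real, Real.norm_eq_abs, div_le_iff₀ ht', mul_assoc,
      min_mul_of_nonneg _ _ ht'.le, mul_min_of_nonneg _ _ (by norm_num), le_min_iff]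
    constructor
    · rwa [abs_mul, mul_comm |t|] at h2
    · refine h1.trans ?_
      rw [mul_pow, ← sq_abs t]
      have ht2 : |t| ^ 2 ≤ |t| := by nlinarith
      nlinarith [mul_le_mul_of_nonneg_right ht2 (sq_nonneg (Y ω))]
  · have hlim : Filter.Tendsto (fun t : ℝ => 3 * |t| * Y ω ^ 2) (𝓝[≠] 0) (𝓝 0) := by
      have : ContinuousAt (fun t : ℝ => 3 * |t| * Y ω ^ 2) 0 := by fun_prop
      exact (by simpa [ContinuousAt] using this : Filter.Tendsto _ _ _).mono_left
        nhdsWithin_le_nhds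
    refine squeeze_zero_norm' ?_ hlim
    filter_upwards [self_mem_nhdsWithin] with t ht0
    have ht' : 0 < |t| := abs_pos.2 ht0
    rw [norm_div, Complex.norm_real, Real.norm_eq_abs, div_le_iff₀ ht']
    refine (norm_cexp_sub_one_sub_le_sq _).1.trans (le_of_eq ?_)
    rw [mul_pow, ← sq_abs t]
    ring

lemma tendsto_cexp_sub_div_sq (y : ℝ) :
    Filter.Tendsto (fun t : ℝ => (Complex.exp ((t * y : ℝ) * Complex.I) - 1 -
      (t * y : ℝ) * Complex.I) / (t : ℂ) ^ 2) (𝓝[≠] 0) (𝓝 ((-(y ^ 2 / 2) : ℝ) : ℂ)) := by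
  have hlim : Filter.Tendsto (fun t : ℝ => |t| * |y| ^ 3 * Real.exp |t * y|) (𝓝[≠] 0) (𝓝 0) := by
    have : ContinuousAt (fun t : ℝ => |t| * |y| ^ 3 * Real.exp |t * y|) 0 := by fun_prop
    exact (by simpa [ContinuousAt] using this : Filter.Tendsto _ _ _).mono_left nhdsWithin_le_nhds
  rw [tendsto_iff_norm_sub_tendsto_zero]
  refine squeeze_zero' (.of_forall fun _ => norm_nonneg _) ?_ hlim
  filter_upwards [self_mem_nhdsWithin] with t ht0
  have ht : (t : ℂ) ≠ 0 := by exact_mod_cast ht0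
  have h := Complex.norm_exp_sub_sum_le_norm_mul_exp (((t * y : ℝ) : ℂ) * Complex.I) 3
  have hn : ‖((t * y : ℝ) : ℂ) * Complex.I‖ = |t * y| := by
    rw [norm_mul, Complex.norm_I, mul_one, Complex.norm_real, Real.norm_eq_abs]
  have e : (Complex.exp ((t * y : ℝ) * Complex.I) - 1 - (t * y : ℝ) * Complex.I) / (t : ℂ) ^ 2 -
      ((-(y ^ 2 / 2) : ℝ) : ℂ) = (Complex.exp ((t * y : ℝ) * Complex.I) -
        ∑ m ∈ Finset.range 3, (((t * y : ℝ) : ℂ) * Complex.I) ^ m / m.factorial) / (t : ℂ) ^ 2 := by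
    simp only [Finset.sum_range_succ, Finset.range_zero, Finset.sum_empty, pow_zero, pow_one,
      mul_pow, Complex.I_sq, Nat.factorial]
    push_cast
    field_simp
    ring
  rw [hn] at h
  have ht' : 0 < |t| := abs_pos.2 ht0
  rw [e, norm_div, norm_pow, Complex.norm_real, Real.norm_eq_abs, div_le_iff₀ (by positivity)]
  refine h.trans (le_of_eq ?_)
  rw [abs_mul]
  ring

lemma tendsto_integral_cexp_sub_div_sq (hm : Measurable Y)
    (hY : Integrable (fun ω => Y ω ^ 2) ρ) :
    Filter.Tendsto (fun t : ℝ => (∫ ω, (Complex.exp ((t * Y ω : ℝ) * Complex.I) - 1 -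
      (t * Y ω : ℝ) * Complex.I) ∂ρ) / (t : ℂ) ^ 2) (𝓝[≠] 0)
      (𝓝 ((-((∫ ω, Y ω ^ 2 ∂ρ) / 2) : ℝ) : ℂ)) := by
  simp_rw [← integral_div]
  rw [← integral_neg, ← integral_complex_ofReal]
  refine tendsto_integral_filter_of_dominated_convergence
    (fun ω => 3 * Y ω ^ 2) (.of_forall fun t => by fun_prop) ?_ (hY.const_mul 3)
    (.of_forall fun ω => tendsto_cexp_sub_div_sq (Y ω))
  filter_upwards [self_mem_nhdsWithin] with t ht0
  refine .of_forall fun ω => ?_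
  have ht' : 0 < |t| := abs_pos.2 ht0
  rw [norm_div, norm_pow, Complex.norm_real, Real.norm_eq_abs, div_le_iff₀ (by positivity), sq_abs]
  refine (norm_cexp_sub_one_sub_le_sq _).1.trans (le_of_eq ?_)
  ring

/-- Since `s → 0`, `exp s - 1` is asymptotic to `s`. Writing it as `s * dslope Complex.exp 0 s`
avoids dividing by a possibly vanishing `s t`. -/
lemma tendsto_cexp_sub_one_div_sq {s : ℝ → ℂ} {c : ℂ}
    (hs : Filter.Tendsto (fun t => s t / (t : ℂ) ^ 2) (𝓝[≠] 0) (𝓝 c)) :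
    Filter.Tendsto (fun t => (Complex.exp (s t) - 1) / (t : ℂ) ^ 2) (𝓝[≠] 0) (𝓝 c) := by
  have ht : Filter.Tendsto (fun t : ℝ => (t : ℂ) ^ 2) (𝓝[≠] 0) (𝓝 0) := by
    have : ContinuousAt (fun t : ℝ => (t : ℂ) ^ 2) 0 := by fun_prop
    exact (by simpa [ContinuousAt] using this : Filter.Tendsto _ _ _).mono_left nhdsWithin_le_nhds
  have hs0 : Filter.Tendsto s (𝓝[≠] 0) (𝓝 0) := by
    have h := hs.mul ht
    rw [mul_zero] at h
    refine h.congr' ?_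
    filter_upwards [self_mem_nhdsWithin] with t ht0
    have : (t : ℂ) ≠ 0 := by exact_mod_cast ht0
    field_simp
  have hd : Filter.Tendsto (dslope Complex.exp 0) (𝓝 0) (𝓝 1) := by
    have h := (continuousAt_dslope_same.2 (Complex.differentiable_exp 0)).tendsto
    rwa [dslope_same, Complex.deriv_exp, Complex.exp_zero] at h
  have h := hs.mul (hd.comp hs0)
  rw [mul_one] at h
  refine h.congr fun t => ?_
  have e := sub_smul_dslope Complex.exp 0 (s t)
  rw [sub_zero, smul_eq_mul, Complex.exp_zero] at e
  rw [← e, Function.comp_apply]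
  ring

end Expansion

/-! ### The center and the first two moments -/

section Mean

variable {d : ℕ} {p : Measure (EuclideanSpace ℝ (Fin d))}

/-- The norm vanishes at `0` and so is in general not submultiplicative, whereas `1 + ‖x‖` is. As
`p` is finite on `{|x| > 1}`, the two moments are finite together; `finiteMomentOn_norm_sq_iff` does
the same for squares. -/
lemma finiteMomentOn_norm_iff (hp : Integrable (fun x => min 1 (‖x‖ ^ 2)) p) :
    FiniteMomentOn (fun x => ‖x‖) {x | 1 < ‖x‖} p ↔
      FiniteMomentOn (fun x => 1 + ‖x‖) {x | 1 < ‖x‖} p := by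
  have := isFiniteMeasure_restrict_norm_gt_one hp
  rw [finiteMomentOn_iff_integrable (fun _ => norm_nonneg _) (by fun_prop),
    finiteMomentOn_iff_integrable (fun _ => by positivity) (by fun_prop)]
  exact (integrable_add_iff_integrable_right (integrable_const 1)).symm

lemma integrable_one_add_norm_sq_iff {τ : Measure (EuclideanSpace ℝ (Fin d))}
    [IsFiniteMeasure τ] :
    Integrable (fun x => (1 + ‖x‖) ^ 2) τ ↔ Integrable (fun x => ‖x‖ ^ 2) τ := by
  constructor <;> intro h
  · refine h.mono' (by fun_prop) (.of_forall fun x => ?_)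
    rw [Real.norm_of_nonneg (by positivity)]
    gcongr
    linarith
  · refine ((h.const_mul 2).add (integrable_const 2)).mono' (by fun_prop) (.of_forall fun x => ?_)
    rw [Real.norm_of_nonneg (by positivity)]
    simp only [Pi.add_apply]
    nlinarith [sq_nonneg (‖x‖ - 1)]

lemma finiteMomentOn_norm_sq_iff (hp : Integrable (fun x => min 1 (‖x‖ ^ 2)) p) :
    FiniteMomentOn (fun x => ‖x‖ ^ 2) {x | 1 < ‖x‖} p ↔
      FiniteMomentOn (fun x => (1 + ‖x‖) ^ 2) {x | 1 < ‖x‖} p := by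
  have := isFiniteMeasure_restrict_norm_gt_one hp
  rw [finiteMomentOn_iff_integrable (fun _ => by positivity) (by fun_prop),
    finiteMomentOn_iff_integrable (fun _ => by positivity) (by fun_prop),
    integrable_one_add_norm_sq_iff]

lemma finiteMomentOn_norm_of_sq (h : FiniteMomentOn (fun x => ‖x‖ ^ 2) {x | 1 < ‖x‖} p) :
    FiniteMomentOn (fun x => ‖x‖) {x | 1 < ‖x‖} p := by
  refine lt_of_le_of_lt (setLIntegral_mono' measurableSet_norm_gt_one fun x hx => ?_) h
  exact ENNReal.ofReal_le_ofReal (le_self_pow₀ (le_of_lt hx) two_ne_zero)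

lemma integrable_id_of_finiteMomentOn (h : FiniteMomentOn (fun x => ‖x‖) {x | 1 < ‖x‖} p) :
    Integrable (fun x => x) (p.restrict {x | 1 < ‖x‖}) :=
  (integrable_norm_iff (by fun_prop)).1
    ((finiteMomentOn_iff_integrable (fun _ => norm_nonneg _) (by fun_prop) _).1 h)

lemma integrable_norm_sq_of_finiteMomentOn (hp : Integrable (fun x => min 1 (‖x‖ ^ 2)) p)
    (h : FiniteMomentOn (fun x => ‖x‖ ^ 2) {x | 1 < ‖x‖} p) :
    Integrable (fun x => ‖x‖ ^ 2) p :=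
  (integrable_iff_restrict _).2 ⟨integrableOn_norm_sq hp,
    (finiteMomentOn_iff_integrable (fun _ => by positivity) (by fun_prop) _).1 h⟩

lemma integrable_min_inner (hp : Integrable (fun x => min 1 (‖x‖ ^ 2)) p)
    (h : Integrable (fun x => x) (p.restrict {x | 1 < ‖x‖})) (z : EuclideanSpace ℝ (Fin d)) :
    Integrable (fun x => min |⟪z, x⟫| (⟪z, x⟫ ^ 2)) p := by
  have hn : ∀ x : EuclideanSpace ℝ (Fin d),
      ‖min |⟪z, x⟫| (⟪z, x⟫ ^ 2)‖ = min |⟪z, x⟫| (⟪z, x⟫ ^ 2) := fun x =>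
    Real.norm_of_nonneg (le_min (abs_nonneg _) (sq_nonneg _))
  have hle := fun x : EuclideanSpace ℝ (Fin d) => abs_real_inner_le_norm z x
  refine (integrable_iff_restrict _).2 ⟨?_, ?_⟩
  · refine ((integrableOn_norm_sq hp).const_mul (‖z‖ ^ 2)).mono' (by fun_prop)
      (.of_forall fun x => ?_)
    rw [hn, ← mul_pow]
    refine (min_le_right _ _).trans ?_
    rw [← sq_abs]
    gcongr
    exact hle x
  · refine (h.norm.const_mul ‖z‖).mono' (by fun_prop) (.of_forall fun x => ?_)
    rw [hn]
    exact (min_le_left _ _).trans (hle x)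

/-- Compensating the large jumps too costs exactly the drift `∫_{|x| > 1} x dp`; this is how `γ`
turns into the center. -/
lemma integral_levyIntegrand_eq (hp : Integrable (fun x => min 1 (‖x‖ ^ 2)) p)
    (h : Integrable (fun x => x) (p.restrict {x | 1 < ‖x‖})) (z : EuclideanSpace ℝ (Fin d)) :
    ∫ x, (Complex.exp ((⟪z, x⟫ : ℝ) * Complex.I) - 1 -
        (⟪z, x⟫ * unitBallInd x : ℝ) * Complex.I) ∂p =
      ∫ x, (Complex.exp ((⟪z, x⟫ : ℝ) * Complex.I) - 1 - (⟪z, x⟫ : ℝ) * Complex.I) ∂p +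
        (⟪∫ x in {x | 1 < ‖x‖}, x ∂p, z⟫ : ℝ) * Complex.I := by
  have := isFiniteMeasure_restrict_norm_gt_one hp
  have h1 : Integrable (fun x => ((⟪z, x⟫ : ℝ) : ℂ) * Complex.I) (p.restrict {x | 1 < ‖x‖}) :=
    (h.const_inner z).ofReal.mul_const _
  have h2 : Integrable (fun x => Complex.exp ((⟪z, x⟫ : ℝ) * Complex.I) - 1)
      (p.restrict {x | 1 < ‖x‖}) := (integrable_cexp_inner_mul_I _ z).sub (integrable_const 1)
  have h3 : Integrable (fun x => Complex.exp ((⟪z, x⟫ : ℝ) * Complex.I) - 1 -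
      (⟪z, x⟫ : ℝ) * Complex.I) p :=
    (integrable_iff_restrict _).2
      ⟨integrable_cexp_sub_of_sq (integrableOn_norm_sq hp) z, h2.sub h1⟩
  rw [integral_eq_add_restrict (integrable_levyIntegrand hp z), integral_eq_add_restrict h3,
    add_assoc]
  congr 1
  · refine integral_congr_ae (ae_restrict_small_eq fun x hx => ?_)
    rw [unitBallInd_of_le hx, mul_one]
  · rw [integral_sub h2 h1, integral_mul_const, integral_complex_ofReal, integral_inner h,
      real_inner_comm, sub_add_cancel]
    refine integral_congr_ae (ae_restrict_big_eq fun x hx => ?_)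
    simp [unitBallInd_of_gt hx]

variable {μ : Measure (EuclideanSpace ℝ (Fin d))} {A : Matrix (Fin d) (Fin d) ℝ}
  {ν : PunctualSignedMeasure d} {γ : EuclideanSpace ℝ (Fin d)}

theorem HasStandardTriplet.isCenter (hμ : HasStandardTriplet μ A ν γ)
    (hpos : Integrable (fun x => x) (ν.posPart.restrict {x | 1 < ‖x‖}))
    (hneg : Integrable (fun x => x) (ν.negPart.restrict {x | 1 < ‖x‖})) :
    IsCenter μ A ν (γ + ν.integralOn (fun x => x) {x | 1 < ‖x‖}) := by
  refine ⟨⟨hpos.norm, hneg.norm⟩, fun z => ?_⟩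
  rw [hμ.charFun_eq, PunctualSignedMeasure.integralOn, PunctualSignedMeasure.integralOn,
    PunctualSignedMeasure.integralOn, Measure.restrict_univ, Measure.restrict_univ,
    integral_levyIntegrand_eq hμ.quasiLevy.integrable_posPart hpos,
    integral_levyIntegrand_eq hμ.quasiLevy.integrable_negPart hneg, inner_add_left,
    inner_sub_left]
  congr 1
  push_cast
  ring

lemma IsCenter.charFun_smul {m : EuclideanSpace ℝ (Fin d)} (hc : IsCenter μ A ν m)
    (z : EuclideanSpace ℝ (Fin d)) (t : ℝ) :
    charFun μ (t • z) = Complex.exp ((t * ⟪m, z⟫ : ℝ) * Complex.I +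
      (-((quadForm A z / 2 : ℝ) : ℂ) * (t : ℂ) ^ 2 +
        (∫ x, (Complex.exp ((t * ⟪z, x⟫ : ℝ) * Complex.I) - 1 -
          (t * ⟪z, x⟫ : ℝ) * Complex.I) ∂ν.posPart -
        ∫ x, (Complex.exp ((t * ⟪z, x⟫ : ℝ) * Complex.I) - 1 -
          (t * ⟪z, x⟫ : ℝ) * Complex.I) ∂ν.negPart))) := by
  have hq : quadForm A (t • z) = t ^ 2 * quadForm A z := by
    simp only [quadForm, map_smul, inner_smul_left, inner_smul_right, conj_trivial]
    ring
  rw [hc.charFun_eq, hq, PunctualSignedMeasure.integralOn, Measure.restrict_univ,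
    Measure.restrict_univ]
  simp only [real_inner_smul_left, real_inner_smul_right]
  congr 1
  push_cast
  ring

lemma charFun_smul_eq_add [IsProbabilityMeasure μ] (hi : Integrable (fun x => x) μ)
    (z : EuclideanSpace ℝ (Fin d)) (t : ℝ) :
    charFun μ (t • z) = 1 + (t * ⟪∫ x, x ∂μ, z⟫ : ℝ) * Complex.I +
      ∫ x, (Complex.exp ((t * ⟪z, x⟫ : ℝ) * Complex.I) - 1 -
        (t * ⟪z, x⟫ : ℝ) * Complex.I) ∂μ := by
  have h1 : Integrable (fun x => Complex.exp ((⟪t • z, x⟫ : ℝ) * Complex.I) - 1) μ :=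
    (integrable_cexp_inner_mul_I μ (t • z)).sub (integrable_const 1)
  have h2 : Integrable (fun x => ((⟪t • z, x⟫ : ℝ) : ℂ) * Complex.I) μ :=
    (hi.const_inner (t • z)).ofReal.mul_const _
  simp_rw [← real_inner_smul_left]
  rw [integral_sub h1 h2, integral_sub (integrable_cexp_inner_mul_I μ (t • z)) (integrable_const 1),
    integral_mul_const, integral_complex_ofReal, integral_inner hi, charFun_apply]
  simp_rw [real_inner_comm (t • z)]
  have e : ⟪t • ∫ x, x ∂μ, z⟫ = ⟪t • z, ∫ x, x ∂μ⟫ := by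
    rw [real_inner_smul_left, real_inner_smul_left, real_inner_comm]
  rw [e]
  simp

/-- The derivative of `t ↦ charFun μ (t • z)` at `0` is computed twice: integrability of `μ` gives
`i⟪∫ x dμ, z⟫`, the centered exponent gives `i⟪m, z⟫`. -/
theorem IsCenter.integral_eq [IsProbabilityMeasure μ] {m : EuclideanSpace ℝ (Fin d)}
    (hc : IsCenter μ A ν m) (hν : ν.IsQuasiLevyType) (hi : Integrable (fun x => x) μ) :
    ∫ x, x ∂μ = m := by
  refine ext_inner_right ℝ fun z => ?_
  have hpos := (integrable_norm_iff (by fun_prop)).1 hc.integrable.1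
  have hneg := (integrable_norm_iff (by fun_prop)).1 hc.integrable.2
  have hmeas : Measurable fun x : EuclideanSpace ℝ (Fin d) => ⟪z, x⟫ := by fun_prop
  have hrp := tendsto_integral_cexp_sub_div hmeas (integrable_min_inner hν.integrable_posPart hpos z)
  have hrn := tendsto_integral_cexp_sub_div hmeas (integrable_min_inner hν.integrable_negPart hneg z)
  have hrμ := tendsto_integral_cexp_sub_div (ρ := μ) hmeas
    ((hi.const_inner z).abs.mono' (by fun_prop) (.of_forall fun x => by
      rw [Real.norm_of_nonneg (le_min (abs_nonneg _) (sq_nonneg _))]; exact min_le_left _ _))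
  have hlin : ∀ c : ℝ, Filter.Tendsto (fun t : ℝ => ((t * c : ℝ) : ℂ) * Complex.I / t) (𝓝[≠] 0)
      (𝓝 (c * Complex.I)) := fun c => by
    refine tendsto_const_nhds.congr' ?_
    filter_upwards [self_mem_nhdsWithin] with t ht0
    have : (t : ℂ) ≠ 0 := by exact_mod_cast ht0
    push_cast
    field_simp
  have hsq : Filter.Tendsto (fun t : ℝ => -((quadForm A z / 2 : ℝ) : ℂ) * (t : ℂ) ^ 2 / t) (𝓝[≠] 0)
      (𝓝 0) := by
    have h : ContinuousAt (fun t : ℝ => -((quadForm A z / 2 : ℝ) : ℂ) * (t : ℂ)) 0 := by fun_prop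
    have h' : Filter.Tendsto (fun t : ℝ => -((quadForm A z / 2 : ℝ) : ℂ) * (t : ℂ)) (𝓝[≠] 0)
      (𝓝 0) := (by simpa [ContinuousAt] using h : Filter.Tendsto _ _ _).mono_left
        nhdsWithin_le_nhds
    refine h'.congr' ?_
    filter_upwards [self_mem_nhdsWithin] with t ht0
    have : (t : ℂ) ≠ 0 := by exact_mod_cast ht0
    field_simp
  have hd1 : HasDerivAt (fun t : ℝ => charFun μ (t • z)) (⟪∫ x, x ∂μ, z⟫ * Complex.I) 0 := by
    rw [hasDerivAt_iff_tendsto_slope_zero]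
    have h := (hlin ⟪∫ x, x ∂μ, z⟫).add hrμ
    rw [add_zero] at h
    refine h.congr fun t => ?_
    rw [zero_add, zero_smul, charFun_zero, probReal_univ, charFun_smul_eq_add hi,
      Complex.real_smul]
    push_cast
    ring
  have hd2 : HasDerivAt (fun t : ℝ => charFun μ (t • z)) (⟪m, z⟫ * Complex.I) 0 := by
    simp_rw [hc.charFun_smul z]
    have h : HasDerivAt (fun t : ℝ => ((t * ⟪m, z⟫ : ℝ) : ℂ) * Complex.I +
      (-((quadForm A z / 2 : ℝ) : ℂ) * (t : ℂ) ^ 2 +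
        (∫ x, (Complex.exp ((t * ⟪z, x⟫ : ℝ) * Complex.I) - 1 -
          (t * ⟪z, x⟫ : ℝ) * Complex.I) ∂ν.posPart -
        ∫ x, (Complex.exp ((t * ⟪z, x⟫ : ℝ) * Complex.I) - 1 -
          (t * ⟪z, x⟫ : ℝ) * Complex.I) ∂ν.negPart))) (⟪m, z⟫ * Complex.I) 0 := by
      rw [hasDerivAt_iff_tendsto_slope_zero]
      have h := (hlin ⟪m, z⟫).add (hsq.add (hrp.sub hrn))
      rw [sub_zero, zero_add, add_zero] at h
      refine h.congr fun t => ?_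
      rw [Complex.real_smul]
      simp
      ring
    simpa using h.cexp
  have h := hd1.unique hd2
  exact_mod_cast mul_right_cancel₀ Complex.I_ne_zero h

/-- Both expansions of `charFun μ (t • z)` have the same linear part because the mean is `m`.
Dividing the rest by `t ^ 2` and letting `t → 0` compares the second-order coefficients. -/
theorem IsCenter.integral_inner_sq [IsProbabilityMeasure μ] {m : EuclideanSpace ℝ (Fin d)}
    (hc : IsCenter μ A ν m) (hi : Integrable (fun x => x) μ) (hm : ∫ x, x ∂μ = m)
    (hμ2 : Integrable (fun x => ‖x‖ ^ 2) μ) (hpos : Integrable (fun x => ‖x‖ ^ 2) ν.posPart)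
    (hneg : Integrable (fun x => ‖x‖ ^ 2) ν.negPart) (z : EuclideanSpace ℝ (Fin d)) :
    ∫ x, ⟪z, x⟫ ^ 2 ∂μ = ⟪m, z⟫ ^ 2 + quadForm A z +
      (∫ x, ⟪z, x⟫ ^ 2 ∂ν.posPart - ∫ x, ⟪z, x⟫ ^ 2 ∂ν.negPart) := by
  have hmeas : Measurable fun x : EuclideanSpace ℝ (Fin d) => ⟪z, x⟫ := by fun_prop
  have hsq : ∀ {τ : Measure (EuclideanSpace ℝ (Fin d))}, Integrable (fun x => ‖x‖ ^ 2) τ →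
      Integrable (fun x => ⟪z, x⟫ ^ 2) τ := fun hτ =>
    (hτ.const_mul (‖z‖ ^ 2)).mono' (by fun_prop) (.of_forall fun x => by
      rw [Real.norm_of_nonneg (sq_nonneg _), ← mul_pow, ← sq_abs]
      gcongr
      exact abs_real_inner_le_norm z x)
  have hrp := tendsto_integral_cexp_sub_div_sq hmeas (hsq hpos)
  have hrn := tendsto_integral_cexp_sub_div_sq hmeas (hsq hneg)
  have hrμ := tendsto_integral_cexp_sub_div_sq hmeas (hsq hμ2)
  have hs : Filter.Tendsto (fun t : ℝ => (-((quadForm A z / 2 : ℝ) : ℂ) * (t : ℂ) ^ 2 +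
        (∫ x, (Complex.exp ((t * ⟪z, x⟫ : ℝ) * Complex.I) - 1 -
          (t * ⟪z, x⟫ : ℝ) * Complex.I) ∂ν.posPart -
        ∫ x, (Complex.exp ((t * ⟪z, x⟫ : ℝ) * Complex.I) - 1 -
          (t * ⟪z, x⟫ : ℝ) * Complex.I) ∂ν.negPart)) / (t : ℂ) ^ 2) (𝓝[≠] 0)
      (𝓝 (-((quadForm A z / 2 : ℝ) : ℂ) +
        (((-((∫ x, ⟪z, x⟫ ^ 2 ∂ν.posPart) / 2) : ℝ) : ℂ) -
          ((-((∫ x, ⟪z, x⟫ ^ 2 ∂ν.negPart) / 2) : ℝ) : ℂ)))) := by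
    refine ((tendsto_const_nhds (x := -((quadForm A z / 2 : ℝ) : ℂ))).add
      (hrp.sub hrn)).congr' ?_
    filter_upwards [self_mem_nhdsWithin] with t ht0
    have : (t : ℂ) ≠ 0 := by exact_mod_cast ht0
    rw [add_div, sub_div, mul_div_cancel_right₀ _ (pow_ne_zero 2 this)]
  have he : Filter.Tendsto (fun t : ℝ => Complex.exp ((t * ⟪m, z⟫ : ℝ) * Complex.I)) (𝓝[≠] 0)
      (𝓝 1) := by
    have h : ContinuousAt (fun t : ℝ => Complex.exp ((t * ⟪m, z⟫ : ℝ) * Complex.I)) 0 := by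
      fun_prop
    exact (by simpa [ContinuousAt] using h : Filter.Tendsto _ _ _).mono_left nhdsWithin_le_nhds
  -- With `u = t * ⟪m, z⟫`: `exp (iu + s) - 1 - iu = (exp (iu) - 1 - iu) + exp (iu) * (exp s - 1)`.
  have hlim := (tendsto_cexp_sub_div_sq ⟪m, z⟫).add (he.mul (tendsto_cexp_sub_one_div_sq hs))
  have h := tendsto_nhds_unique hrμ (hlim.congr fun t => ?_)
  · norm_cast at h
    linarith
  · have h1 := charFun_smul_eq_add hi z t
    rw [hc.charFun_smul z, Complex.exp_add, hm] at h1
    rw [mul_div_assoc', ← add_div, mul_sub, h1]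
    ring

end Mean

end

/-! ### Matrix entries by polarization, and transfer to a random vector. -/

noncomputable section

/-! ### The covariance matrix -/

section Covariance

variable {d : ℕ} {μ : Measure (EuclideanSpace ℝ (Fin d))} {A : Matrix (Fin d) (Fin d) ℝ}
  {ν : PunctualSignedMeasure d} {γ : EuclideanSpace ℝ (Fin d)}

lemma integrable_coord_mul {τ : Measure (EuclideanSpace ℝ (Fin d))}
    (hτ : Integrable (fun x => ‖x‖ ^ 2) τ) (i j : Fin d) :
    Integrable (fun x => x i * x j) τ :=
  hτ.mono' (by fun_prop) (.of_forall fun x => by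
    rw [norm_mul, sq]
    exact mul_le_mul (PiLp.norm_apply_le x i) (PiLp.norm_apply_le x j) (norm_nonneg _)
      (norm_nonneg _))

lemma integral_inner_single_add_sq {τ : Measure (EuclideanSpace ℝ (Fin d))}
    (hτ : Integrable (fun x => ‖x‖ ^ 2) τ) (i j : Fin d) :
    ∫ x, ⟪EuclideanSpace.single i (1 : ℝ) + EuclideanSpace.single j 1, x⟫ ^ 2 ∂τ =
      ∫ x, x i * x i ∂τ + ∫ x, x j * x j ∂τ + 2 * ∫ x, x i * x j ∂τ := by
  have h := integrable_coord_mul hτ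
  rw [← integral_const_mul, ← integral_add (h i i) (h j j),
    ← integral_add (f := fun x => x i * x i + x j * x j) ((h i i).add (h j j))
    ((h i j).const_mul 2)]
  refine integral_congr_ae (.of_forall fun x => ?_)
  simp only [inner_add_left, EuclideanSpace.inner_single_left, map_one, one_mul]
  ring

lemma integral_inner_single_sq {τ : Measure (EuclideanSpace ℝ (Fin d))} (i : Fin d) :
    ∫ x, ⟪EuclideanSpace.single i (1 : ℝ), x⟫ ^ 2 ∂τ = ∫ x, x i * x i ∂τ := by
  simp [EuclideanSpace.inner_single_left, sq]

lemma quadForm_single (A : Matrix (Fin d) (Fin d) ℝ) (i : Fin d) :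
    quadForm A (EuclideanSpace.single i 1) = A i i := by
  simp [quadForm_eq_dotProduct]

lemma quadForm_single_add (A : Matrix (Fin d) (Fin d) ℝ) (i j : Fin d) :
    quadForm A (EuclideanSpace.single i 1 + EuclideanSpace.single j 1) =
      A i i + A j j + (A i j + A j i) := by
  simp [quadForm_eq_dotProduct, Matrix.mulVec_add]
  ring

/-- Polarization: the quadratic identity at `eᵢ + eⱼ` minus those at `eᵢ` and `eⱼ`. Symmetry of `A`
merges the two off-diagonal entries. -/
theorem IsCenter.integral_coord_mul [IsProbabilityMeasure μ] {m : EuclideanSpace ℝ (Fin d)}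
    (hc : IsCenter μ A ν m) (hA : A.IsSymm) (hi : Integrable (fun x => x) μ)
    (hm : ∫ x, x ∂μ = m) (hμ2 : Integrable (fun x => ‖x‖ ^ 2) μ)
    (hpos : Integrable (fun x => ‖x‖ ^ 2) ν.posPart)
    (hneg : Integrable (fun x => ‖x‖ ^ 2) ν.negPart) (i j : Fin d) :
    ∫ x, x i * x j ∂μ = m i * m j + A i j +
      (∫ x, x i * x j ∂ν.posPart - ∫ x, x i * x j ∂ν.negPart) := by
  have h := hc.integral_inner_sq hi hm hμ2 hpos hneg
  have h1 := h (EuclideanSpace.single i 1)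
  have h2 := h (EuclideanSpace.single j 1)
  have h3 := h (EuclideanSpace.single i 1 + EuclideanSpace.single j 1)
  rw [integral_inner_single_sq, integral_inner_single_sq, integral_inner_single_sq,
    quadForm_single] at h1 h2
  rw [integral_inner_single_add_sq hμ2, integral_inner_single_add_sq hpos,
    integral_inner_single_add_sq hneg, quadForm_single_add, hA.apply i j] at h3
  simp only [inner_add_right, EuclideanSpace.inner_single_right, conj_trivial, one_mul] at h1 h2 h3
  linear_combination (h3 - h1 - h2) / 2

variable {Ω : Type*} [MeasurableSpace Ω] {P : Measure Ω}
  {X : Ω → EuclideanSpace ℝ (Fin d)}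

lemma integrable_comp_iff_of_hasLaw {F : Type*} [NormedAddCommGroup F] (hX : HasLaw X μ P)
    {f : EuclideanSpace ℝ (Fin d) → F} (hf : AEStronglyMeasurable f μ) :
    Integrable (fun ω => f (X ω)) P ↔ Integrable f μ := by
  rw [← hX.map_eq] at hf ⊢
  exact (integrable_map_measure hf hX.aemeasurable).symm

/-- The moment equivalence for `1 + ‖x‖` carries integrability from `ν⁺` to both `μ` and `ν⁻`, so
the center exists and equals the mean. -/
theorem HasStandardTriplet.integrable_and_isCenter (hμ : HasStandardTriplet μ A ν γ)
    (h : FiniteMomentOn (fun x => ‖x‖) {x | 1 < ‖x‖} ν.posPart) :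
    Integrable (fun x => x) μ ∧ ν.IntegrableOn (fun x => x) {x | 1 < ‖x‖} ∧
      IsCenter μ A ν (γ + ν.integralOn (fun x => x) {x | 1 < ‖x‖}) ∧
      ∫ x, x ∂μ = γ + ν.integralOn (fun x => x) {x | 1 < ‖x‖} := by
  have := hμ.qid.1
  have hs : IsSubmultiplicative fun x : EuclideanSpace ℝ (Fin d) => 1 + ‖x‖ :=
    ⟨fun x => by positivity, 1, one_pos, fun x y => by
      nlinarith [norm_add_le x y, mul_nonneg (norm_nonneg x) (norm_nonneg y)]⟩
  obtain ⟨h1, h2⟩ := (hμ.finiteMoment_iff hs (isLocallyBounded_of_continuous (by fun_prop))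
    (by fun_prop)).1 ((finiteMomentOn_norm_iff hμ.quasiLevy.integrable_posPart).1 h)
  rw [← finiteMomentOn_norm_iff hμ.quasiLevy.integrable_negPart] at h2
  rw [finiteMomentOn_iff_integrable (fun _ => by positivity) (by fun_prop),
    Measure.restrict_univ] at h1
  replace h1 := (integrable_norm_iff (by fun_prop)).1
    ((integrable_add_iff_integrable_right (integrable_const 1)).1 h1)
  have hpos := integrable_id_of_finiteMomentOn h
  have hneg := integrable_id_of_finiteMomentOn h2
  have hc := hμ.isCenter hpos hneg
  exact ⟨h1, ⟨hpos, hneg⟩, hc, hc.integral_eq hμ.quasiLevy h1⟩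

theorem HasStandardTriplet.integrable_norm_sq (hμ : HasStandardTriplet μ A ν γ)
    (h : FiniteMomentOn (fun x => ‖x‖ ^ 2) {x | 1 < ‖x‖} ν.posPart) :
    Integrable (fun x => ‖x‖ ^ 2) μ ∧ Integrable (fun x => ‖x‖ ^ 2) ν.posPart ∧
      Integrable (fun x => ‖x‖ ^ 2) ν.negPart := by
  have := hμ.qid.1
  have hs : IsSubmultiplicative fun x : EuclideanSpace ℝ (Fin d) => (1 + ‖x‖) ^ 2 :=
    ⟨fun x => by positivity, 1, one_pos, fun x y => by
      rw [one_mul, ← mul_pow]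
      refine pow_le_pow_left₀ (by positivity) ?_ 2
      nlinarith [norm_add_le x y, mul_nonneg (norm_nonneg x) (norm_nonneg y)]⟩
  obtain ⟨h1, h2⟩ := (hμ.finiteMoment_iff hs (isLocallyBounded_of_continuous (by fun_prop))
    (by fun_prop)).1 ((finiteMomentOn_norm_sq_iff hμ.quasiLevy.integrable_posPart).1 h)
  rw [← finiteMomentOn_norm_sq_iff hμ.quasiLevy.integrable_negPart] at h2
  rw [finiteMomentOn_iff_integrable (fun _ => by positivity) (by fun_prop),
    Measure.restrict_univ, integrable_one_add_norm_sq_iff] at h1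
  exact ⟨h1, integrable_norm_sq_of_finiteMomentOn hμ.quasiLevy.integrable_posPart h,
    integrable_norm_sq_of_finiteMomentOn hμ.quasiLevy.integrable_negPart h2⟩

theorem HasStandardTriplet.covarianceMatrix_eq (hμ : HasStandardTriplet μ A ν γ)
    (hX : HasLaw X μ P) (h : FiniteMomentOn (fun x => ‖x‖ ^ 2) {x | 1 < ‖x‖} ν.posPart) :
    covarianceMatrix X P = A + secondMomentMatrix ν := by
  have := hμ.qid.1
  obtain ⟨hμ2, hpos, hneg⟩ := hμ.integrable_norm_sq h
  -- On `{|x| > 1}` the second moment dominates the first, so the mean is available.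
  obtain ⟨hi, -, hc, hm⟩ := hμ.integrable_and_isCenter (finiteMomentOn_norm_of_sq h)
  set m := γ + ν.integralOn (fun x => x) {x | 1 < ‖x‖}
  have hcoord : ∀ i, MemLp (fun x : EuclideanSpace ℝ (Fin d) => x i) 2 μ := fun i =>
    (memLp_two_iff_integrable_sq (by fun_prop)).2 (by
      simpa only [sq] using integrable_coord_mul hμ2 i i)
  have hmean : ∀ i, ∫ x, x i ∂μ = m i := fun i => by
    rw [← hm]
    exact (EuclideanSpace.proj (𝕜 := ℝ) i).integral_comp_comm hi
  ext i j
  have e : covarianceMatrix X P i j = covariance (fun x => x i) (fun x => x j) μ :=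
    hX.covariance_comp (f := fun x => x i) (g := fun x => x j) (by fun_prop) (by fun_prop)
  rw [e, covariance_eq_sub (hcoord i) (hcoord j), hmean, hmean, Matrix.add_apply,
    secondMomentMatrix, Matrix.of_apply, PunctualSignedMeasure.integralOn, Measure.restrict_univ,
    Measure.restrict_univ]
  simp only [Pi.mul_apply]
  rw [hc.integral_coord_mul hμ.symm hi hm hμ2 hpos hneg i j]
  ring

end Covariance

end

theorem mainTheorem4 {d : ℕ} (μ : Measure (EuclideanSpace ℝ (Fin d)))
    (A : Matrix (Fin d) (Fin d) ℝ) (ν : PunctualSignedMeasure d) (γ : EuclideanSpace ℝ (Fin d))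
    (hμ : HasStandardTriplet μ A ν γ) :
    -- (a) finiteness of submultiplicative moments
    (∀ h : EuclideanSpace ℝ (Fin d) → ℝ,
      IsSubmultiplicative h → IsLocallyBounded h → Measurable h →
      (FiniteMomentOn h {x | 1 < ‖x‖} ν.posPart ↔
        FiniteMomentOn h Set.univ μ ∧ FiniteMomentOn h {x | 1 < ‖x‖} ν.negPart)) ∧
    -- (b) moments of a random vector `X` with distribution `μ`
    (∀ (Ω : Type*) (_ : MeasurableSpace Ω) (P : Measure Ω) (X : Ω → EuclideanSpace ℝ (Fin d)),
      IsProbabilityMeasure P → HasLaw X μ P →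
      -- (i) the mean
      (FiniteMomentOn (fun x => ‖x‖) {x | 1 < ‖x‖} ν.posPart →
        Integrable X P ∧
        ν.IntegrableOn (fun x => x) {x | 1 < ‖x‖} ∧
        ∫ ω, X ω ∂P = γ + ν.integralOn (fun x => x) {x | 1 < ‖x‖} ∧
        IsCenter μ A ν (γ + ν.integralOn (fun x => x) {x | 1 < ‖x‖})) ∧
      -- (ii) the covariance matrix
      (FiniteMomentOn (fun x => ‖x‖ ^ 2) {x | 1 < ‖x‖} ν.posPart →
        MemLp X 2 P ∧
        (∀ i j, ν.IntegrableOn (fun x => x i * x j) Set.univ) ∧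
        covarianceMatrix X P = A + secondMomentMatrix ν) ∧
      -- (iii) exponential moments
      (∀ α : EuclideanSpace ℝ (Fin d),
        FiniteMomentOn (fun x => Real.exp ⟪α, x⟫) {x | 1 < ‖x‖} ν.posPart →
        Integrable (fun ω => Real.exp ⟪α, X ω⟫) P ∧
        ν.IntegrableOn (fun x => Real.exp ⟪α, x⟫ - 1 - ⟪α, x⟫ * unitBallInd x) Set.univ ∧
        ∫ ω, Real.exp ⟪α, X ω⟫ ∂P =
          Real.exp (⟪α, γ⟫ + quadForm A α / 2 +
            ν.integralOn (fun x => Real.exp ⟪α, x⟫ - 1 - ⟪α, x⟫ * unitBallInd x) Set.univ))) := by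
  refine ⟨fun h hs hb hm => hμ.finiteMoment_iff hs hb hm, fun Ω _ P X _ hX => ⟨fun h => ?_,
    fun h => ?_, fun α hα => ?_⟩⟩
  · obtain ⟨hi, hν, hc, hm⟩ := hμ.integrable_and_isCenter h
    exact ⟨(integrable_comp_iff_of_hasLaw hX (by fun_prop)).2 hi, hν, hX.integral_eq.trans hm, hc⟩
  · obtain ⟨hμ2, hpos, hneg⟩ := hμ.integrable_norm_sq h
    refine ⟨?_, fun i j => ⟨(integrable_coord_mul hpos i j).integrableOn,
      (integrable_coord_mul hneg i j).integrableOn⟩, hμ.covarianceMatrix_eq hX h⟩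
    exact (memLp_two_iff_integrable_sq_norm hX.aemeasurable.aestronglyMeasurable).2
      ((integrable_comp_iff_of_hasLaw hX (by fun_prop)).2 hμ2)
  · obtain ⟨hi, hν, he⟩ := hμ.exp_moment hα
    refine ⟨(integrable_comp_iff_of_hasLaw hX hi.1).2 hi, hν, ?_⟩
    rw [← he]
    exact hX.integral_comp hi.1
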